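/- Let $p\ge 1$ and $a_0,\dots,a_p\in\mathbb C$ with $a_p\neq 0$. Define monic polynomials $(Q_n)$ by $Q_0=1$, $Q_n=0$ for $n<0$, and $$\lambda Q_n(\lambda)=Q_{n+1}(\lambda)+a_0Q_n(\lambda)+\cdots+a_pQ_{n-p}(\lambda),\qquad n\ge 0.$$ Let $A$ be the bounded operator on $\ell^2=\ell^2(\{0,1,2,\dots\})$ given by the infinite Toeplitz matrix with $1$ on the first superdiagonal, $a_k$ on the $k$-th subdiagonal ($0\le k\le p$, $k=0$ being the main diagonal) and $0$ elsewhere. Let $\mathbf e_0,\mathbf e_1,\dots$ be the standard unit vectors of $\ell^2$ and $(\cdot,\cdot)$ its standard inner product, linear in the first argument. For $1\le j\le p$ put $$g_j(\lambda)=\big((\lambda I-A)^{-1}\mathbf e_{j-1},\mathbf e_0\big)\quad\text{for $\lambda$ outside the spectrum of $A$},$$ and let $L_j$ be the linear functional on polynomials with $L_j(\lambda^k)=(A^k(\mathbf e_0+\cdots+\mathbf e_{j-1}),\mathbf e_0)$ for $k\ge0$. For $\lambda\in\mathbb C$ let $z_0(\lambda),\dots,z_p(\lambda)$ be the $p+1$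 solutions, counted with multiplicity, of $$a(z)=\frac1z+a_0+a_1z+\cdots+a_pz^p=\lambda,$$ labelled so that $|z_0(\lambda)|\le\cdots\le|z_p(\lambda)|$ (ties broken arbitrarily), and let $\Gamma_1=\{\lambda\in\mathbb C:|z_0(\lambda)|=|z_1(\lambda)|\}$. For $n=mp+k$ with $m\ge0$ and $0\le k\le p-1$, let $\mathbf n=(n_1,\dots,n_p)$ be the staircase multi-index with $n_j=m+1$ for $1\le j\le k$ and $n_j=m$ for $k<j\le p$; thus $n_1+\cdots+n_p=n$. Then: i) $(g_1(\lambda),\dots,g_p(\lambda))=(z_0(\lambda),\dots,z_0(\lambda)^p)$ for every $\lambda$ outside the spectrum of $A$; in particular, for each $j=1,\dots,p$ the functions $g_j$ and $z_0^j$ have the same convergent Laurent expansion $\sum_{m\ge0}c_{j,m}\lambda^{-m-1}$ in a neighbourhood of $\infty$. ii) For all $n\ge0$ and $1\le j\le p$, $L_j(\lambda^kQ_n(\lambda))=0$ for $k=0,\dots,n_j-1$. iii) For all $n\ge0$, $\left(\frac{Q_{n-1}}{Q_n},\dots,\frac{Q_{n-p}}{Q_n}\right)$ is a type II Hermite–Padé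 approximant to $(z_0,\dots,z_0^p)$ at $\infty$ with respect to $\mathbf n$: $Q_n$ is a nonzero polynomial of degree at most $n_1+\cdots+n_p$, and for $j=1,\dots,p$ $$Q_n(\lambda)z_0(\lambda)^j-Q_{n-j}(\lambda)=\mathcal O\!\left(\frac1{\lambda^{n_j+1}}\right),\qquad\lambda\to\infty.$$ iv) For each $j=1,\dots,p$, $z_0^j$ and all the quotients $Q_{n-j}/Q_n$ tend to $0$ as $\lambda\to\infty$; extend them to $\infty$ by the value $0$. For every compact subset $K$ of $\overline{\mathbb C}\setminus\Gamma_1$ the polynomial $Q_n$ has no zeros on $K\cap\mathbb C$ for all sufficiently large $n$, and $$\lim_{n\to\infty}\frac{Q_{n-j}(\lambda)}{Q_n(\lambda)}=z_0(\lambda)^j$$ uniformly on $K$. -/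

import Mathlib

open Polynomial Filter Topology Bornology

noncomputable section

namespace ToeplitzRec

/-- The Hilbert space `ℓ²` of square-summable complex sequences indexed by `0, 1, 2, …`. -/
abbrev Ell2 : Type := lp (fun _ : ℕ => ℂ) 2

/-- The unit vector of `ℓ²` with `1` in the entry of index `i` (entries are counted from `0`). -/
def basisVec (i : ℕ) : Ell2 := lp.single 2 i (1 : ℂ)

theorem memℓp_left (x : Ell2) : Memℓp (fun n : ℕ => x (n + 1)) 2 := by
  refine memℓp_gen ?_
  exact (summable_nat_add_iff (f := fun n => ‖x n‖ ^ (2 : ENNReal).toReal) 1).2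
    ((lp.memℓp x).summable (by norm_num))

theorem memℓp_right (x : Ell2) :
    Memℓp (fun n : ℕ => if n = 0 then (0 : ℂ) else x (n - 1)) 2 := by
  refine memℓp_gen ?_
  rw [← summable_nat_add_iff 1]
  simpa using (lp.memℓp x).summable (by norm_num)

/-- The backward shift `(x₀, x₁, …) ↦ (x₁, x₂, …)` on `ℓ²`. -/
def leftShift : Ell2 →L[ℂ] Ell2 :=
  LinearMap.mkContinuous
    { toFun := fun x => ⟨fun n => x (n + 1), memℓp_left x⟩
      map_add' := fun x y => by ext n; rfl
      map_smul' := fun c x => by ext n; simp } 1 (fun x => by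
    rw [one_mul]
    refine lp.norm_le_of_tsum_le (by norm_num) (norm_nonneg x) ?_
    rw [lp.norm_rpow_eq_tsum (by norm_num) x]
    have hs := (lp.memℓp x).summable (by norm_num : 0 < (2 : ENNReal).toReal)
    have h := hs.sum_add_tsum_nat_add 1
    rw [← h]
    simp only [LinearMap.coe_mk, AddHom.coe_mk]
    have : 0 ≤ ∑ i ∈ Finset.range 1, ‖x i‖ ^ (2 : ENNReal).toReal :=
      Finset.sum_nonneg fun i _ => by positivity
    linarith)

/-- The forward shift `(x₀, x₁, …) ↦ (0, x₀, x₁, …)` on `ℓ²`. -/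
def rightShift : Ell2 →L[ℂ] Ell2 :=
  LinearMap.mkContinuous
    { toFun := fun x => ⟨fun n => if n = 0 then 0 else x (n - 1), memℓp_right x⟩
      map_add' := fun x y => by
        ext n
        change (if n = 0 then (0 : ℂ) else (x + y) (n - 1)) =
          (if n = 0 then 0 else x (n - 1)) + (if n = 0 then 0 else y (n - 1))
        by_cases h : n = 0 <;> simp [h]
      map_smul' := fun c x => by ext n; by_cases h : n = 0 <;> simp [h] } 1 (fun x => by
    rw [one_mul]
    refine lp.norm_le_of_tsum_le (by norm_num) (norm_nonneg x) ?_
    rw [lp.norm_rpow_eq_tsum (by norm_num) x]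
    have hs := (memℓp_right x).summable (by norm_num : 0 < (2 : ENNReal).toReal)
    have h := hs.sum_add_tsum_nat_add 1
    simp only [LinearMap.coe_mk, AddHom.coe_mk]
    rw [← h]
    simp)

variable {p : ℕ}

/-- The entry of index `(i, j)`, `i, j = 0, 1, …`, of the infinite banded Hessenberg (Toeplitz)
matrix `A` with `1` on the first superdiagonal, `a k` on the `k`-th subdiagonal for `0 ≤ k ≤ p`
and `0` elsewhere. -/
def toeplitzMatrix (a : Fin (p + 1) → ℂ) (i j : ℕ) : ℂ :=
  if j = i + 1 then 1
  else if h : j ≤ i ∧ i - j < p + 1 then a ⟨i - j, h.2⟩ else 0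

/-- The bounded operator on `ℓ²` given by the matrix `A`. -/
def toeplitzOp (a : Fin (p + 1) → ℂ) : Ell2 →L[ℂ] Ell2 :=
  leftShift + ∑ k : Fin (p + 1), a k • rightShift ^ (k : ℕ)

/-- `g_j(w) = (R_w e_{j-1}, e_0)` with `R_w = (w I - A)⁻¹`. The inner product of Mathlib is linear
in its second argument, so its arguments are swapped. -/
def resolventFun (a : Fin (p + 1) → ℂ) (j : ℕ) (w : ℂ) : ℂ :=
  inner ℂ (basisVec 0) (resolvent (toeplitzOp a) w (basisVec (j - 1)))

/-- `v_j = e_0 + ⋯ + e_{j-1}`. -/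
def vVec (j : ℕ) : Ell2 := ∑ i ∈ Finset.range j, basisVec i

/-- The linear functional on polynomials with `L_j(X ^ n) = (A ^ n v_j, e_0)`. -/
def LFun (a : Fin (p + 1) → ℂ) (j : ℕ) : ℂ[X] →ₗ[ℂ] ℂ where
  toFun P := inner ℂ (basisVec 0) (aeval (toeplitzOp a) P (vVec j))
  map_add' P R := by simp
  map_smul' c P := by simp

/-- The polynomials `Q_0, Q_1, …`: `Q_0 = 1` and
`Q_{n+1} = X Q_n - a_0 Q_n - ⋯ - a_p Q_{n-p}`, where polynomials of negative index are zero. -/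
def recPolyNat (a : Fin (p + 1) → ℂ) : ℕ → ℂ[X]
  | 0 => 1
  | n + 1 => X * recPolyNat a n -
      ∑ k : Fin (p + 1), if (k : ℕ) ≤ n then C (a k) * recPolyNat a (n - k) else 0
  termination_by n => n
  decreasing_by all_goals omega

/-- The polynomials `Q_n` for all integers `n`, with `Q_n = 0` for `n < 0`. -/
def QPoly (a : Fin (p + 1) → ℂ) : ℤ → ℂ[X]
  | Int.ofNat n => recPolyNat a n
  | Int.negSucc _ => 0

/-- The symbol `a(z) = 1 / z + a_0 + a_1 z + ⋯ + a_p z ^ p`. -/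
def symbol (a : Fin (p + 1) → ℂ) (z : ℂ) : ℂ := z⁻¹ + ∑ k : Fin (p + 1), a k * z ^ (k : ℕ)

/-- The polynomial `z (a(z) - w)` in `z`; its zeros are the solutions of `a(z) = w`. -/
def symbolPoly (a : Fin (p + 1) → ℂ) (w : ℂ) : ℂ[X] :=
  1 + ∑ k : Fin (p + 1), C (a k) * X ^ ((k : ℕ) + 1) - C w * X

/-- `z_0(w), …, z_p(w)` are, for every `w`, the `p + 1` solutions of `a(z) = w` counted with
multiplicity and labelled so that `|z_0(w)| ≤ ⋯ ≤ |z_p(w)|`. Ties are broken arbitrarily. -/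
def IsOrderedSolution (a : Fin (p + 1) → ℂ) (z : Fin (p + 1) → ℂ → ℂ) : Prop :=
  ∀ w : ℂ, (symbolPoly a w).roots = Multiset.map (fun k => z k w) Finset.univ.val ∧
    Monotone fun k => ‖z k w‖

/-- `Gamma z i` is the set `Γ_{i+1} = {w : |z_i(w)| = |z_{i+1}(w)|}`, `i = 0, …, p - 1`. -/
def Gamma (z : Fin (p + 1) → ℂ → ℂ) (i : Fin p) : Set ℂ :=
  {w | ‖z i.castSucc w‖ = ‖z i.succ w‖}

/-- The component `n_j`, `1 ≤ j ≤ p`, of the staircase multi-index of `n = m p + k`,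
`0 ≤ k < p`: it is `m + 1` for `j ≤ k` and `m` for `j > k`. -/
def stair (p n j : ℕ) : ℕ := if j ≤ n % p then n / p + 1 else n / p

/-- `f(w) = c_0 / w + c_1 / w ^ 2 + ⋯` for all `w` in a neighbourhood of infinity. -/
def HasLaurentAtInfty (f : ℂ → ℂ) (c : ℕ → ℂ) : Prop :=
  ∀ᶠ w in cobounded ℂ, HasSum (fun m : ℕ => c m / w ^ (m + 1)) (f w)

/-- `(P_1 / D, …, P_p / D)` is a type II Hermite–Padé approximant to `(f_1, …, f_p)` at infinity
for the multi-index `(ν_1, …, ν_p)`: `D` is a nonzero polynomial of degree at most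
`ν_1 + ⋯ + ν_p`, the `P_j` are polynomials, and `D f_j - P_j = O(1 / w ^ (ν_j + 1))`. -/
def IsTypeIIHermitePade (p : ℕ) (f : ℕ → ℂ → ℂ) (ν : ℕ → ℕ) (D : ℂ[X]) (P : ℕ → ℂ[X]) : Prop :=
  D ≠ 0 ∧ D.natDegree ≤ ∑ j ∈ Finset.Icc 1 p, ν j ∧
    ∀ j ∈ Finset.Icc 1 p,
      (fun w : ℂ => D.eval w * f j w - (P j).eval w) =O[cobounded ℂ]
        fun w : ℂ => 1 / w ^ (ν j + 1)

/-- The extension of `f : ℂ → ℂ` to the extended plane by the value `0` at infinity. -/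
def extendByZero (f : ℂ → ℂ) (w : OnePoint ℂ) : ℂ := w.elim 0 f

theorem leftShift_apply (x : Ell2) (n : ℕ) : leftShift x n = x (n + 1) := rfl

theorem rightShift_apply (x : Ell2) (n : ℕ) :
    rightShift x n = if n = 0 then 0 else x (n - 1) := rfl

theorem rightShift_pow_apply (k : ℕ) (x : Ell2) (n : ℕ) :
    (rightShift ^ k) x n = if k ≤ n then x (n - k) else 0 := by
  induction k generalizing n with
  | zero => simp
  | succ k ih =>
    rw [pow_succ', mul_apply_eq_comp, rightShift_apply]
    rcases n with _ | n
    · simp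
    · rw [if_neg (by omega), ih]
      simp

/-- The operator acts on a sequence by the recurrence. -/
theorem toeplitzOp_apply (a : Fin (p + 1) → ℂ) (x : Ell2) (n : ℕ) :
    toeplitzOp a x n =
      x (n + 1) + ∑ k : Fin (p + 1), if (k : ℕ) ≤ n then a k * x (n - k) else 0 := by
  simp only [toeplitzOp, _root_.add_apply, lp.coeFn_add, Pi.add_apply,
    leftShift_apply, _root_.sum_apply, lp.coeFn_sum, Finset.sum_apply,
    _root_.smul_apply, lp.coeFn_smul, Pi.smul_apply, rightShift_pow_apply,
    smul_eq_mul, mul_ite, mul_zero]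

theorem inner_e (i : ℕ) (x : Ell2) : inner ℂ (basisVec i) x = x i := by
  simp [basisVec, lp.inner_single_left]

/-- The matrix entries of the operator are those of `A`. -/
theorem inner_toeplitzOp (a : Fin (p + 1) → ℂ) (i j : ℕ) :
    inner ℂ (basisVec i) (toeplitzOp a (basisVec j)) = toeplitzMatrix a i j := by
  have he : ∀ m, (basisVec j) m = if m = j then (1 : ℂ) else 0 := fun m => by
    simp [basisVec, lp.single_apply, Pi.single_apply]
  rw [inner_e, toeplitzOp_apply]
  simp only [he, toeplitzMatrix]
  by_cases h1 : j = i + 1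
  · subst h1
    simp only [if_true]
    rw [Finset.sum_eq_zero, add_zero]
    intro k _
    split_ifs <;> first | omega | simp
  · rw [if_neg (fun h => h1 h.symm), if_neg h1, zero_add]
    by_cases h : j ≤ i ∧ i - j < p + 1
    · rw [dif_pos h, Finset.sum_eq_single ⟨i - j, h.2⟩]
      · have : i - (i - j) = j := by omega
        simp [this]
      · intro k _ hk
        have : (k : ℕ) ≠ i - j := fun hh => hk (Fin.ext hh)
        split_ifs <;> first | omega | simp
      · simp
    · rw [dif_neg h]
      refine Finset.sum_eq_zero fun k _ => ?_
      have := k.2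
      split_ifs <;> first | omega | simp

theorem LFun_X_pow (a : Fin (p + 1) → ℂ) (j n : ℕ) :
    LFun a j (X ^ n) = inner ℂ (basisVec 0) ((toeplitzOp a ^ n) (vVec j)) := by
  simp [LFun]

theorem QPoly_zero (a : Fin (p + 1) → ℂ) : QPoly a 0 = 1 := by
  change recPolyNat a 0 = 1
  rw [recPolyNat]

theorem QPoly_neg (a : Fin (p + 1) → ℂ) {n : ℤ} (hn : n < 0) : QPoly a n = 0 := by
  obtain ⟨m, rfl⟩ := Int.eq_negSucc_of_lt_zero hn
  rfl

/-- The `(p + 2)`-term recurrence. -/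
theorem QPoly_rec (a : Fin (p + 1) → ℂ) (n : ℕ) :
    X * QPoly a n = QPoly a (n + 1) + ∑ k : Fin (p + 1), C (a k) * QPoly a (n - (k : ℕ)) := by
  have h1 : QPoly a (n + 1) = recPolyNat a (n + 1) := rfl
  have h0 : QPoly a n = recPolyNat a n := rfl
  have hs : ∀ k : Fin (p + 1), C (a k) * QPoly a (n - (k : ℕ)) =
      if (k : ℕ) ≤ n then C (a k) * recPolyNat a (n - k) else 0 := fun k => by
    split_ifs with h
    · rw [← Nat.cast_sub h]; rfl
    · rw [QPoly_neg a (by omega), mul_zero]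
  rw [h1, h0, recPolyNat]
  simp only [hs]
  ring

theorem symbolPoly_eval (a : Fin (p + 1) → ℂ) (w z : ℂ) (hz : z ≠ 0) :
    (symbolPoly a w).eval z = z * (symbol a z - w) := by
  simp only [symbolPoly, symbol, eval_sub, eval_add, eval_one, eval_finsetSum, eval_mul, eval_C,
    eval_pow, eval_X, mul_sub, mul_add, mul_inv_cancel₀ hz, Finset.mul_sum]
  congr 1
  · congr 1
    exact Finset.sum_congr rfl fun k _ => by ring
  · ring

end ToeplitzRec

end

open ToeplitzRec

/-! The first row of `(w I - A)⁻¹`, preceded by `1`, solves the recurrence with characteristic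
polynomial `symbolPoly a w`, and it tends to zero because the resolvent is bounded. If all
characteristic roots had modulus at least one, it would vanish identically
(`exists_root_norm_lt_one`); hence `|z_0(w)| < 1` off the spectrum. The row `(z_0, z_0², …)` is then
a left solution for `w I - A` (`mul_tsum_pow_mul_sub`), so it is that first row. This gives i), with
the Laurent series coming from the Neumann series.

The first row of `Q_n(A)` is the unit row of index `n`, so `L_j(λ^k Q_n)` is the entry of index `n`
of `A^k v_j`. It vanishes as long as the band has not carried the support of `v_j` that far, which
is ii). The entry of index `n` of `(w I - A)⁻¹ e_{j-1}` is `Q_n z_0^j - Q_{n-j}`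
(`IsOrderedSolution.QPoly_mul_pow_sub`), and the same support count gives its order at infinity,
which is iii).

For iv), the generating function of `Q_n(w)` is the product of the `1 / (1 - t / z_k)`. Replacing
`t` by `z_0 t` shows that `z_0^n Q_n` is a partial sum of the coefficients of the product over `k ≥
1` of `1 / (1 - (z_0 / z_k) t)` (`IsOrderedSolution.pow_mul_QPoly`). Where `|z_0| < |z_1|` these
sums have a nonzero limit, and dividing two of them gives the ratio. Uniformity on `K` needs one `q
< 1` with `|z_0 / z_1| ≤ q`; it comes from compactness, the continuity of the ordered root moduli
(`tendsto_norm_roots`) and their behaviour at infinity. -/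

namespace ToeplitzRec

variable {p : ℕ}

/-! ### The first row of the resolvent and the Laurent expansion -/

section Resolvent

variable {a : Fin (p + 1) → ℂ} {w : ℂ}

theorem basisVec_apply (i m : ℕ) : basisVec i m = if m = i then (1 : ℂ) else 0 := by
  simp [basisVec, lp.single_apply, Pi.single_apply]

theorem leftShift_basisVec_zero : leftShift (basisVec 0) = 0 := by
  ext n
  simp [leftShift_apply, basisVec_apply]

theorem leftShift_basisVec_succ (i : ℕ) : leftShift (basisVec (i + 1)) = basisVec i := by
  ext n
  simp [leftShift_apply, basisVec_apply]

theorem rightShift_pow_basisVec (k i : ℕ) :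
    (rightShift ^ k) (basisVec i) = basisVec (i + k) := by
  ext n
  simp only [rightShift_pow_apply, basisVec_apply]
  split_ifs <;> first | rfl | omega

theorem toeplitzOp_basisVec (a : Fin (p + 1) → ℂ) (i : ℕ) :
    toeplitzOp a (basisVec i) =
      leftShift (basisVec i) + ∑ k : Fin (p + 1), a k • basisVec (i + k) := by
  simp only [toeplitzOp, _root_.add_apply, _root_.sum_apply, _root_.smul_apply,
    rightShift_pow_basisVec]

theorem sub_resolvent_apply (hw : w ∈ resolventSet ℂ (toeplitzOp a)) (x : Ell2) :
    w • resolvent (toeplitzOp a) w x - toeplitzOp a (resolvent (toeplitzOp a) w x) = x := by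
  have h : (algebraMap ℂ (Ell2 →L[ℂ] Ell2) w - toeplitzOp a) * resolvent (toeplitzOp a) w = 1 :=
    Ring.mul_inverse_cancel _ hw
  simpa [Algebra.algebraMap_eq_smul_one] using congr($h x)

theorem resolvent_sub_apply (hw : w ∈ resolventSet ℂ (toeplitzOp a)) (x : Ell2) :
    resolvent (toeplitzOp a) w (w • x - toeplitzOp a x) = x := by
  have h : resolvent (toeplitzOp a) w * (algebraMap ℂ (Ell2 →L[ℂ] Ell2) w - toeplitzOp a) = 1 :=
    Ring.inverse_mul_cancel _ hw
  simpa [Algebra.algebraMap_eq_smul_one] using congr($h x)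

theorem tendsto_apply_zero (x : Ell2) : Tendsto (fun n => x n) atTop (𝓝 0) := by
  have h := (lp.memℓp x).summable (by norm_num : 0 < (2 : ENNReal).toReal)
  have h2 := h.tendsto_atTop_zero
  simp only [ENNReal.toReal_ofNat, Real.rpow_ofNat] at h2
  rw [tendsto_zero_iff_norm_tendsto_zero]
  simpa using h2.sqrt

/-- The matrix entries of a bounded operator in a fixed row tend to zero. -/
theorem tendsto_row_zero (T : Ell2 →L[ℂ] Ell2) (m : ℕ) :
    Tendsto (fun i => T (basisVec i) m) atTop (𝓝 0) := by
  have h := (tendsto_apply_zero (ContinuousLinearMap.adjoint T (basisVec m))).star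
  rw [star_zero] at h
  refine h.congr fun i => ?_
  rw [← inner_e m, ← ContinuousLinearMap.adjoint_inner_left, ← inner_e i]
  exact inner_conj_symm _ _

/-- The shift of complex sequences. -/
def seqShift : Module.End ℂ (ℕ → ℂ) where
  toFun f n := f (n + 1)
  map_add' _ _ := rfl
  map_smul' _ _ := rfl

theorem seqShift_pow_apply (k : ℕ) (f : ℕ → ℂ) (n : ℕ) : (seqShift ^ k) f n = f (n + k) := by
  induction k generalizing n with
  | zero => simp
  | succ k ih =>
    rw [pow_succ', Module.End.mul_apply]
    change (seqShift ^ k) f (n + 1) = _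
    rw [ih]
    congr 1
    omega

/-- A geometric sequence of ratio `ζ` has nondecreasing moduli, and these lie below their limit
zero. -/
theorem eq_zero_of_seqShift_sub {ζ : ℂ} (hζ : 1 ≤ ‖ζ‖) {f : ℕ → ℂ}
    (hf : Tendsto f atTop (𝓝 0)) (h : aeval seqShift (X - C ζ) f = 0) : f = 0 := by
  have hstep : ∀ n, f (n + 1) = ζ * f n := fun n => by
    have := congrFun h n
    simp only [map_sub, aeval_X, aeval_C, LinearMap.sub_apply, Pi.sub_apply,
      Module.algebraMap_end_apply, Pi.smul_apply, smul_eq_mul, Pi.zero_apply, sub_eq_zero] at this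
    exact this
  have hmono : Monotone fun n => ‖f n‖ := monotone_nat_of_le_succ fun n => by
    rw [hstep, norm_mul]
    exact le_mul_of_one_le_left (norm_nonneg _) hζ
  funext n
  have := hmono.ge_of_tendsto (by simpa using hf.norm) n
  simpa using this

/-- Needed to peel off the characteristic factors one at a time: what remains after each factor is
again a null sequence. -/
theorem tendsto_aeval_seqShift (P : ℂ[X]) {f : ℕ → ℂ} (hf : Tendsto f atTop (𝓝 0)) :
    Tendsto (aeval seqShift P f) atTop (𝓝 0) := by
  induction P using Polynomial.induction_on' with
  | add P R hP hR =>
    rw [map_add, LinearMap.add_apply, ← add_zero (0 : ℂ)]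
    exact hP.add hR
  | monomial n c =>
    have : aeval seqShift (monomial n c) f = fun m => c * f (m + n) := by
      funext m
      simp [aeval_monomial, seqShift_pow_apply]
    rw [this]
    simpa using ((tendsto_add_atTop_iff_nat n).2 hf).const_mul c

/-- A linear recurrence whose characteristic roots all have modulus at least one has no nonzero
solution tending to zero. -/
theorem eq_zero_of_aeval_seqShift {s : Multiset ℂ} (hs : ∀ ζ ∈ s, 1 ≤ ‖ζ‖) {f : ℕ → ℂ}
    (hf : Tendsto f atTop (𝓝 0))
    (h : aeval seqShift (s.map fun ζ => X - C ζ).prod f = 0) : f = 0 := by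
  induction s using Multiset.induction generalizing f with
  | empty => simpa using h
  | cons ζ s ih =>
    rw [Multiset.map_cons, Multiset.prod_cons, map_mul, Module.End.mul_apply] at h
    exact ih (fun η hη => hs η (Multiset.mem_cons_of_mem hη)) hf
      (eq_zero_of_seqShift_sub (hs ζ (Multiset.mem_cons_self ζ s))
        (tendsto_aeval_seqShift _ hf) h)

theorem symbolPoly_ne_zero (a : Fin (p + 1) → ℂ) (w : ℂ) : symbolPoly a w ≠ 0 := by
  intro h
  have := congrArg (eval 0) h
  simp [symbolPoly, eval_finsetSum] at this

/-- The first row of the resolvent, preceded by `1`, solves the recurrence with characteristic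
polynomial `symbolPoly a w`. -/
theorem aeval_seqShift_symbolPoly (hw : w ∈ resolventSet ℂ (toeplitzOp a)) :
    aeval seqShift (symbolPoly a w)
      (fun n => if n = 0 then 1 else resolvent (toeplitzOp a) w (basisVec (n - 1)) 0) = 0 := by
  set R := resolvent (toeplitzOp a) w with hR
  funext n
  have key := congr(($(resolvent_sub_apply hw (basisVec n)) : Ell2) 0)
  rw [← hR, toeplitzOp_basisVec] at key
  have hsum : (R (∑ k : Fin (p + 1), a k • basisVec (n + k)) : Ell2) 0 =
      ∑ k : Fin (p + 1), a k * R (basisVec (n + k)) 0 := by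
    rw [map_sum, lp.coeFn_sum, Finset.sum_apply]
    simp
  rw [map_sub, map_smul, map_add, lp.coeFn_sub, Pi.sub_apply, lp.coeFn_smul, Pi.smul_apply,
    lp.coeFn_add, Pi.add_apply, hsum, basisVec_apply, smul_eq_mul] at key
  -- The prepended `1` absorbs the inhomogeneity of the equation at `n = 0`, where the left shift
  -- contributes nothing.
  have hn : (if n = 0 then 1 else (R (basisVec (n - 1)) 0 : ℂ)) =
      (if 0 = n then 1 else 0) + R (leftShift (basisVec n)) 0 := by
    rcases n with _ | n
    · simp [leftShift_basisVec_zero]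
    · simp [leftShift_basisVec_succ]
  simp only [symbolPoly, map_sub, map_add, map_one, map_sum, map_mul, aeval_C, aeval_X, map_pow,
    LinearMap.sub_apply, LinearMap.add_apply, Module.End.one_apply, LinearMap.sum_apply,
    Module.End.mul_apply, Module.algebraMap_end_apply, Pi.sub_apply, Pi.add_apply,
    Finset.sum_apply, Pi.smul_apply, seqShift_pow_apply, smul_eq_mul, Pi.zero_apply]
  rw [hn, ← key]
  have h1 : seqShift (fun n => if n = 0 then 1 else (R (basisVec (n - 1)) 0 : ℂ)) n =
      R (basisVec n) 0 := rfl
  have h2 : ∀ k : ℕ, n + (k + 1) ≠ 0 ∧ n + (k + 1) - 1 = n + k := fun k => by omega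
  simp only [h1, if_neg (h2 _).1, (h2 _).2]
  ring

/-- Outside the spectrum the equation `a(z) = w` has a solution in the open unit disc. -/
theorem exists_root_norm_lt_one (hw : w ∈ resolventSet ℂ (toeplitzOp a)) :
    ∃ ζ ∈ (symbolPoly a w).roots, ‖ζ‖ < 1 := by
  by_contra! hcon
  have hspl := (IsAlgClosed.splits (symbolPoly a w)).eq_prod_roots
  have hA := aeval_seqShift_symbolPoly hw
  set f : ℕ → ℂ :=
    fun n => if n = 0 then 1 else resolvent (toeplitzOp a) w (basisVec (n - 1)) 0 with hf
  rw [hspl, map_mul, aeval_C, Module.End.mul_apply, Module.algebraMap_end_apply] at hA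
  have hlim : Tendsto f atTop (𝓝 0) := by
    rw [← tendsto_add_atTop_iff_nat 1]
    simpa [hf] using tendsto_row_zero (resolvent (toeplitzOp a) w) 0
  have h0 := eq_zero_of_aeval_seqShift hcon hlim
    ((smul_eq_zero.1 hA).resolve_left (leadingCoeff_ne_zero.2 (symbolPoly_ne_zero a w)))
  simpa [hf] using congrFun h0 0

theorem ne_zero_of_mem_roots {ζ : ℂ} (hζ : ζ ∈ (symbolPoly a w).roots) : ζ ≠ 0 := by
  rintro rfl
  have := (mem_roots'.1 hζ).2
  simp [symbolPoly, eval_finsetSum] at this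

theorem summable_pow_mul {ζ : ℂ} (hζ : ‖ζ‖ < 1) (x : Ell2) :
    Summable fun n : ℕ => ζ ^ n * x n := by
  refine Summable.of_norm_bounded (g := fun n => ‖ζ‖ ^ n * ‖x‖)
    ((summable_geometric_of_lt_one (norm_nonneg _) hζ).mul_right _) fun n => ?_
  rw [norm_mul, norm_pow]
  gcongr
  exact lp.norm_apply_le_norm (by norm_num) x n

theorem tsum_pow_mul_rightShift {ζ : ℂ} (hζ : ‖ζ‖ < 1) (x : Ell2) (k : ℕ) :
    ∑' n : ℕ, ζ ^ n * (rightShift ^ k) x n = ζ ^ k * ∑' n : ℕ, ζ ^ n * x n := by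
  rw [← (summable_pow_mul hζ _).sum_add_tsum_nat_add k, ← tsum_mul_left, Finset.sum_eq_zero,
    zero_add]
  · refine tsum_congr fun n => ?_
    rw [rightShift_pow_apply, if_pos (by omega), Nat.add_sub_cancel]
    ring
  · intro n hn
    rw [rightShift_pow_apply, if_neg (by simpa using hn), mul_zero]

theorem mul_tsum_pow_mul_leftShift {ζ : ℂ} (hζ : ‖ζ‖ < 1) (x : Ell2) :
    ζ * ∑' n : ℕ, ζ ^ n * leftShift x n = ∑' n : ℕ, ζ ^ n * x n - x 0 := by
  rw [← (summable_pow_mul hζ x).sum_add_tsum_nat_add 1, ← tsum_mul_left]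
  simp only [Finset.range_one, Finset.sum_singleton, pow_zero, one_mul, add_sub_cancel_left]
  exact tsum_congr fun n => by rw [leftShift_apply]; ring

/-- A root of `symbolPoly a w` in the open unit disc gives a left eigenvector of the Toeplitz
matrix up to the zeroth entry. -/
theorem mul_tsum_pow_mul_sub {ζ : ℂ} (hζ : ‖ζ‖ < 1) (hr : (symbolPoly a w).eval ζ = 0)
    (x : Ell2) : ζ * ∑' n : ℕ, ζ ^ n * (w • x - toeplitzOp a x) n = x 0 := by
  have hexp : ∀ n, ζ ^ n * (w • x - toeplitzOp a x) n = w * (ζ ^ n * x n) -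
      (ζ ^ n * leftShift x n + ∑ k : Fin (p + 1), a k * (ζ ^ n * (rightShift ^ (k : ℕ)) x n)) := by
    intro n
    rw [lp.coeFn_sub, Pi.sub_apply, lp.coeFn_smul, Pi.smul_apply, smul_eq_mul, toeplitzOp_apply,
      leftShift_apply, mul_sub, mul_add, Finset.mul_sum]
    congr 1
    · ring
    · congr 1
      refine Finset.sum_congr rfl fun k _ => ?_
      rw [rightShift_pow_apply]
      split_ifs <;> ring
  have hsr : ∀ k ∈ (Finset.univ : Finset (Fin (p + 1))),
      Summable fun n : ℕ => a k * (ζ ^ n * (rightShift ^ (k : ℕ)) x n) :=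
    fun k _ => (summable_pow_mul hζ _).mul_left _
  simp_rw [hexp]
  rw [((summable_pow_mul hζ x).mul_left w).tsum_sub
      ((summable_pow_mul hζ _).add (summable_sum hsr)),
    (summable_pow_mul hζ _).tsum_add (summable_sum hsr), Summable.tsum_finsetSum hsr,
    mul_sub, mul_add, mul_tsum_pow_mul_leftShift hζ]
  simp only [tsum_mul_left, tsum_pow_mul_rightShift hζ]
  simp only [symbolPoly, eval_sub, eval_add, eval_one, eval_finsetSum, eval_mul, eval_C,
    eval_pow, eval_X] at hr
  have hfac : ζ * ∑ k : Fin (p + 1), a k * (ζ ^ (k : ℕ) * ∑' n : ℕ, ζ ^ n * x n) =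
      (∑ k : Fin (p + 1), a k * ζ ^ ((k : ℕ) + 1)) * ∑' n : ℕ, ζ ^ n * x n := by
    rw [Finset.mul_sum, Finset.sum_mul]
    exact Finset.sum_congr rfl fun k _ => by ring
  rw [hfac]
  linear_combination (-∑' n : ℕ, ζ ^ n * x n) * hr

variable {z : Fin (p + 1) → ℂ → ℂ}

theorem IsOrderedSolution.mem_roots (hz : IsOrderedSolution a z) (k : Fin (p + 1)) (w : ℂ) :
    z k w ∈ (symbolPoly a w).roots := by
  rw [(hz w).1]
  exact Multiset.mem_map_of_mem _ (Finset.mem_univ k)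

theorem IsOrderedSolution.ne_zero (hz : IsOrderedSolution a z) (k : Fin (p + 1)) (w : ℂ) :
    z k w ≠ 0 :=
  ne_zero_of_mem_roots (hz.mem_roots k w)

theorem IsOrderedSolution.norm_zero_lt_one (hz : IsOrderedSolution a z)
    (hw : w ∈ resolventSet ℂ (toeplitzOp a)) : ‖z 0 w‖ < 1 := by
  obtain ⟨ζ, hζ, h1⟩ := exists_root_norm_lt_one hw
  rw [(hz w).1] at hζ
  obtain ⟨k, -, rfl⟩ := Multiset.mem_map.1 hζ
  exact ((hz w).2 (Fin.zero_le k)).trans_lt h1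

/-- Pairing the row of powers of `z_0` with `(w I - A) x = e_i`, where `x` is the resolvent column,
leaves a single term. -/
theorem IsOrderedSolution.resolvent_apply_zero (hz : IsOrderedSolution a z)
    (hw : w ∈ resolventSet ℂ (toeplitzOp a)) (i : ℕ) :
    resolvent (toeplitzOp a) w (basisVec i) 0 = z 0 w ^ (i + 1) := by
  rw [← mul_tsum_pow_mul_sub (hz.norm_zero_lt_one hw) (mem_roots'.1 (hz.mem_roots 0 w)).2,
    sub_resolvent_apply hw, tsum_eq_single i]
  · simp [basisVec_apply, pow_succ']
  · intro m hm
    simp [basisVec_apply, hm]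

theorem IsOrderedSolution.resolventFun_eq (hz : IsOrderedSolution a z)
    (hw : w ∈ resolventSet ℂ (toeplitzOp a)) {j : ℕ} (hj : 1 ≤ j) :
    resolventFun a j w = z 0 w ^ j := by
  rw [resolventFun, inner_e, hz.resolvent_apply_zero hw, Nat.sub_add_cancel hj]

theorem eventually_mem_resolventSet (a : Fin (p + 1) → ℂ) :
    ∀ᶠ w in cobounded ℂ, w ∈ resolventSet ℂ (toeplitzOp a) := by
  filter_upwards [spectrum.eventually_isUnit_resolvent (𝕜 := ℂ) (toeplitzOp a)] with w hw
  exact spectrum.isUnit_resolvent.2 hw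

/-- The Neumann series of the resolvent, read off in one matrix entry for `|w| > ‖A‖`. -/
theorem hasLaurentAtInfty_resolventFun (a : Fin (p + 1) → ℂ) (j : ℕ) :
    HasLaurentAtInfty (resolventFun a j)
      (fun m => (toeplitzOp a ^ m) (basisVec (j - 1)) 0) := by
  have hbig : ∀ᶠ w in cobounded ℂ, ‖toeplitzOp a‖ + 1 ≤ ‖w‖ :=
    tendsto_norm_cobounded_atTop.eventually_ge_atTop _
  filter_upwards [hbig] with w hw
  have hpos : 0 < ‖w‖ := by have := norm_nonneg (toeplitzOp a); linarith
  have hw0 : w ≠ 0 := norm_pos_iff.1 hpos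
  have hlt : ‖w⁻¹ • toeplitzOp a‖ < 1 := by
    rw [norm_smul, norm_inv, inv_mul_lt_iff₀ hpos]
    linarith
  have h := (hasSum_geom_series_inverse _ hlt).const_smul w⁻¹
  have hres : w⁻¹ • Ring.inverse (1 - w⁻¹ • toeplitzOp a) = resolvent (toeplitzOp a) w := by
    have := spectrum.units_smul_resolvent_self (r := Units.mk0 w hw0) (a := toeplitzOp a)
    simp only [resolvent, map_one, Units.smul_def, Units.val_mk0, Units.val_inv_eq_inv_val] at this
    rw [← this, inv_smul_smul₀ hw0]
    rfl
  rw [hres] at h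
  have h2 := (h.mapL (ContinuousLinearMap.apply ℂ Ell2 (basisVec (j - 1)))).mapL
    (innerSL ℂ (basisVec 0))
  have hterm : ∀ m : ℕ, innerSL ℂ (basisVec 0) (ContinuousLinearMap.apply ℂ Ell2
      (basisVec (j - 1)) (w⁻¹ • (w⁻¹ • toeplitzOp a) ^ m)) =
      (toeplitzOp a ^ m) (basisVec (j - 1)) 0 / w ^ (m + 1) := fun m => by
    rw [ContinuousLinearMap.apply_apply, innerSL_apply_apply, inner_e, _root_.smul_pow,
      _root_.smul_apply, _root_.smul_apply, lp.coeFn_smul, Pi.smul_apply, lp.coeFn_smul,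
      Pi.smul_apply, smul_eq_mul, smul_eq_mul, inv_pow, pow_succ]
    field_simp
  simp only [hterm] at h2
  exact h2

end Resolvent

/-! ### Multiple orthogonality and Hermite–Padé approximation -/

section HermitePade

variable {a : Fin (p + 1) → ℂ} {w : ℂ}

theorem QPoly_natCast (a : Fin (p + 1) → ℂ) (n : ℕ) : QPoly a n = recPolyNat a n := rfl

theorem recPolyNat_succ (a : Fin (p + 1) → ℂ) (n : ℕ) :
    recPolyNat a (n + 1) = X * recPolyNat a n -
      ∑ k : Fin (p + 1), if (k : ℕ) ≤ n then C (a k) * recPolyNat a (n - k) else 0 := by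
  rw [recPolyNat]

/-- The first row of `Q_n(A)` is the unit row vector of index `n`. -/
theorem aeval_QPoly_apply_zero (a : Fin (p + 1) → ℂ) (n : ℕ) (x : Ell2) :
    aeval (toeplitzOp a) (QPoly a n) x 0 = x n := by
  rw [QPoly_natCast]
  induction n using Nat.strong_induction_on generalizing x with
  | _ n ih =>
  rcases n with _ | n
  · simp [recPolyNat]
  · have hsum : (aeval (toeplitzOp a) (∑ k : Fin (p + 1),
        if (k : ℕ) ≤ n then C (a k) * recPolyNat a (n - k) else 0) x : Ell2) 0 =
        ∑ k : Fin (p + 1), if (k : ℕ) ≤ n then a k * x (n - k) else 0 := by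
      rw [map_sum, _root_.sum_apply, lp.coeFn_sum, Finset.sum_apply]
      refine Finset.sum_congr rfl fun k _ => ?_
      split_ifs with hk
      · rw [map_mul, aeval_C, Algebra.algebraMap_eq_smul_one, smul_one_mul, _root_.smul_apply,
          lp.coeFn_smul, Pi.smul_apply, smul_eq_mul, ih (n - k) (by omega)]
      · simp
    -- Commuting `X` to the right makes `Q_n(A)` act on `A x`; hence the induction over all vectors.
    rw [recPolyNat_succ, map_sub, _root_.sub_apply, lp.coeFn_sub, Pi.sub_apply, hsum, mul_comm X,
      map_mul, aeval_X, mul_apply_eq_comp, ih n (by omega), toeplitzOp_apply]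
    ring

/-- Each application of the operator enlarges the support of a finite vector by at most `p`. -/
theorem toeplitzOp_pow_apply_eq_zero (a : Fin (p + 1) → ℂ) {x : Ell2} {s : ℕ}
    (hx : ∀ n, s < n → x n = 0) (k : ℕ) {n : ℕ} (hn : s + p * k < n) :
    (toeplitzOp a ^ k) x n = 0 := by
  induction k generalizing n with
  | zero => simpa using hx n (by simpa using hn)
  | succ k ih =>
    rw [mul_add, mul_one] at hn
    rw [pow_succ', mul_apply_eq_comp, toeplitzOp_apply, ih (by omega), zero_add]
    refine Finset.sum_eq_zero fun i _ => ?_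
    have := i.2
    split_ifs
    · rw [ih (by omega), mul_zero]
    · rfl

/-- The origin of the staircase: `n_j` counts the powers of `A` that cannot carry the support of
`e_0, …, e_{j-1}` to the index `n`. -/
theorem lt_of_lt_stair {n j k : ℕ} (hj : j ∈ Finset.Icc 1 p)
    (hk : k < stair p n j) : j - 1 + p * k < n := by
  rw [Finset.mem_Icc] at hj
  have hdiv := Nat.div_add_mod n p
  rw [stair] at hk
  split_ifs at hk with h
  · have : p * k ≤ p * (n / p) := Nat.mul_le_mul_left p (by omega)
    omega
  · have : p * (k + 1) ≤ p * (n / p) := Nat.mul_le_mul_left p (by omega)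
    rw [mul_add] at this
    omega

theorem LFun_X_pow_mul_QPoly (a : Fin (p + 1) → ℂ) {n j k : ℕ}
    (hj : j ∈ Finset.Icc 1 p) (hk : k < stair p n j) :
    LFun a j (X ^ k * QPoly a n) = 0 := by
  change inner ℂ (basisVec 0) (aeval (toeplitzOp a) (X ^ k * QPoly a n) (vVec j)) = 0
  rw [inner_e, mul_comm, map_mul, mul_apply_eq_comp, aeval_QPoly_apply_zero, map_pow, aeval_X]
  refine toeplitzOp_pow_apply_eq_zero a (s := j - 1) (fun m hm => ?_) k (lt_of_lt_stair hj hk)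
  rw [vVec, lp.coeFn_sum, Finset.sum_apply]
  refine Finset.sum_eq_zero fun i hi => ?_
  rw [Finset.mem_range] at hi
  rw [basisVec_apply, if_neg (by omega)]

/-- Over all integers the recurrence has a unit source at `-1`, which creates `Q_0`. The shifted
sequence `Q_{n-i-1}` then has its source at `n = i`, like column `i` of the resolvent. -/
theorem eval_QPoly_rec (a : Fin (p + 1) → ℂ) (w : ℂ) (m : ℤ) :
    (QPoly a (m + 1)).eval w = w * (QPoly a m).eval w -
      ∑ k : Fin (p + 1), a k * (QPoly a (m - (k : ℕ))).eval w + if m = -1 then 1 else 0 := by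
  rcases lt_trichotomy m (-1) with h | rfl | h
  · rw [QPoly_neg a (by omega), QPoly_neg a (by omega), if_neg (by omega), Finset.sum_eq_zero]
    · simp
    · intro k _
      rw [QPoly_neg a (by omega)]
      simp
  · rw [QPoly_neg a (by omega : (-1 : ℤ) < 0), Finset.sum_eq_zero]
    · simp [QPoly_zero]
    · intro k _
      rw [QPoly_neg a (by omega)]
      simp
  · lift m to ℕ using by omega
    have := congrArg (eval w) (QPoly_rec a m)
    simp only [eval_mul, eval_X, eval_add, eval_finsetSum, eval_C] at this
    rw [if_neg (by omega)]
    linear_combination -this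

/-- The columns of the resolvent, in terms of their zeroth entries. -/
theorem resolvent_apply_eq (hw : w ∈ resolventSet ℂ (toeplitzOp a)) (i n : ℕ) :
    resolvent (toeplitzOp a) w (basisVec i) n =
      (QPoly a n).eval w * resolvent (toeplitzOp a) w (basisVec i) 0 -
        (QPoly a (n - (i + 1 : ℕ))).eval w := by
  have key := fun n => congr(($(sub_resolvent_apply hw (basisVec i)) : Ell2) n)
  set x := resolvent (toeplitzOp a) w (basisVec i)
  induction n using Nat.strong_induction_on with
  | _ n ih =>
  rcases n with _ | n
  · rw [QPoly_neg a (n := ((0 : ℕ) : ℤ) - (i + 1 : ℕ)) (by push_cast; omega)]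
    simp [QPoly_zero]
  · have h := key n
    rw [lp.coeFn_sub, Pi.sub_apply, lp.coeFn_smul, Pi.smul_apply, smul_eq_mul, toeplitzOp_apply,
      basisVec_apply, ih n (by omega)] at h
    have hs : (∑ k : Fin (p + 1), if (k : ℕ) ≤ n then a k * x (n - k) else 0) =
        (∑ k : Fin (p + 1), a k * (QPoly a (n - (k : ℕ))).eval w) * x 0 -
          ∑ k : Fin (p + 1), a k * (QPoly a (((n : ℤ) - (i + 1 : ℕ)) - (k : ℕ))).eval w := by
      rw [Finset.sum_mul, ← Finset.sum_sub_distrib]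
      refine Finset.sum_congr rfl fun k _ => ?_
      split_ifs with hk
      · rw [ih (n - k) (by omega), Nat.cast_sub hk, sub_right_comm (n : ℤ)]
        ring
      · rw [QPoly_neg a (n := (n : ℤ) - (k : ℕ)) (by omega),
          QPoly_neg a (n := (n : ℤ) - (i + 1 : ℕ) - (k : ℕ)) (by push_cast; omega)]
        simp
    have h1 := eval_QPoly_rec a w n
    have h2 := eval_QPoly_rec a w ((n : ℤ) - (i + 1 : ℕ))
    rw [if_neg (by omega)] at h1
    have h3 : (if (n : ℤ) - (i + 1 : ℕ) = -1 then (1 : ℂ) else 0) = if n = i then 1 else 0 := by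
      congr 1
      simp only [eq_iff_iff]
      push_cast
      omega
    rw [h3] at h2
    rw [hs] at h
    have h4 : ((n + 1 : ℕ) : ℤ) - (i + 1 : ℕ) = (n : ℤ) - (i + 1 : ℕ) + 1 := by push_cast; ring
    rw [h4, h2, Nat.cast_add, Nat.cast_one, h1]
    linear_combination -h

theorem IsOrderedSolution.QPoly_mul_pow_sub {z : Fin (p + 1) → ℂ → ℂ}
    (hz : IsOrderedSolution a z) (hw : w ∈ resolventSet ℂ (toeplitzOp a)) (n : ℕ) {j : ℕ}
    (hj : 1 ≤ j) :
    (QPoly a n).eval w * z 0 w ^ j - (QPoly a (n - (j : ℕ))).eval w =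
      resolvent (toeplitzOp a) w (basisVec (j - 1)) n := by
  rw [resolvent_apply_eq hw, hz.resolvent_apply_zero hw, Nat.sub_add_cancel hj]

/-- Iterates `w R x = x + A R x`; the vanishing entries remove the polynomial part of the expansion
of `w ^ N R x`. -/
theorem resolvent_apply_eq_pow (hw : w ∈ resolventSet ℂ (toeplitzOp a)) (x : Ell2) {n N : ℕ}
    (hN : ∀ m < N, (toeplitzOp a ^ m) x n = 0) :
    w ^ N * resolvent (toeplitzOp a) w x n =
      (toeplitzOp a ^ N) (resolvent (toeplitzOp a) w x) n := by
  induction N with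
  | zero => simp
  | succ N ih =>
    have h := congr((toeplitzOp a ^ N) $(sub_resolvent_apply hw x))
    have hcomp : (toeplitzOp a ^ N) (toeplitzOp a (resolvent (toeplitzOp a) w x)) =
        (toeplitzOp a ^ (N + 1)) (resolvent (toeplitzOp a) w x) := by
      rw [pow_succ, mul_apply_eq_comp]
    rw [map_sub, map_smul, hcomp] at h
    have h1 := congr(($h : Ell2) n)
    rw [hN N (by omega), lp.coeFn_sub, Pi.sub_apply, lp.coeFn_smul, Pi.smul_apply, smul_eq_mul,
      ← ih fun m hm => hN m (by omega)] at h1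
    linear_combination h1

theorem isBigO_resolvent_apply (a : Fin (p + 1) → ℂ) (x : Ell2) {n N : ℕ}
    (hN : ∀ m < N, (toeplitzOp a ^ m) x n = 0) :
    (fun w : ℂ => resolvent (toeplitzOp a) w x n) =O[cobounded ℂ]
      fun w : ℂ => 1 / w ^ (N + 1) := by
  obtain ⟨c, hc⟩ := (spectrum.resolvent_isBigO_inv (𝕜 := ℂ) (toeplitzOp a)).bound
  refine Asymptotics.IsBigO.of_bound (‖toeplitzOp a ^ N‖ * c * ‖x‖) ?_
  filter_upwards [hc, eventually_mem_resolventSet a, eventually_ne_cobounded (0 : ℂ)]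
    with w h1 h2 h3
  have h4 := resolvent_apply_eq_pow h2 x hN
  have h5 : ‖w ^ N * resolvent (toeplitzOp a) w x n‖ ≤ ‖toeplitzOp a ^ N‖ * (c * ‖w⁻¹‖ * ‖x‖) := by
    rw [h4]
    refine (lp.norm_apply_le_norm (by norm_num) _ n).trans ?_
    refine (ContinuousLinearMap.le_opNorm _ _).trans ?_
    gcongr
    refine (ContinuousLinearMap.le_opNorm _ _).trans ?_
    gcongr
  have h6 : 0 < ‖w‖ := norm_pos_iff.2 h3
  rw [norm_mul, norm_pow, norm_inv] at h5
  rw [norm_div, norm_one, norm_pow w, mul_one_div, le_div_iff₀ (by positivity), pow_succ]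
  calc _ = ‖w‖ ^ N * ‖resolvent (toeplitzOp a) w x n‖ * ‖w‖ := by ring
    _ ≤ ‖toeplitzOp a ^ N‖ * (c * ‖w‖⁻¹ * ‖x‖) * ‖w‖ := by gcongr
    _ = _ := by
      generalize ‖toeplitzOp a ^ N‖ = t
      field_simp

theorem IsOrderedSolution.isBigO_QPoly_mul_pow_sub {z : Fin (p + 1) → ℂ → ℂ}
    (hz : IsOrderedSolution a z) (n : ℕ) {j : ℕ} (hj : j ∈ Finset.Icc 1 p) :
    (fun w : ℂ => (QPoly a n).eval w * z 0 w ^ j - (QPoly a (n - (j : ℕ))).eval w)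
      =O[cobounded ℂ] fun w : ℂ => 1 / w ^ (stair p n j + 1) := by
  refine (isBigO_resolvent_apply a (basisVec (j - 1)) (n := n) fun m hm => ?_).congr' ?_
    EventuallyEq.rfl
  · refine toeplitzOp_pow_apply_eq_zero a (s := j - 1) (fun i hi => ?_) m
      (lt_of_lt_stair hj hm)
    rw [basisVec_apply, if_neg (by omega)]
  · filter_upwards [eventually_mem_resolventSet a] with w hw
    exact (hz.QPoly_mul_pow_sub hw n (Finset.mem_Icc.1 hj).1).symm

theorem sum_stair (hp : 1 ≤ p) (n : ℕ) : ∑ j ∈ Finset.Icc 1 p, stair p n j = n := by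
  have h : ∀ j, stair p n j = n / p + if j ≤ n % p then 1 else 0 := fun j => by
    rw [stair]
    split_ifs <;> rfl
  have hmod : n % p < p := Nat.mod_lt n hp
  simp only [h, Finset.sum_add_distrib, Finset.sum_const, Nat.card_Icc, smul_eq_mul,
    Finset.sum_boole, Nat.cast_id]
  have hf : (Finset.Icc 1 p).filter (fun j => j ≤ n % p) = Finset.Icc 1 (n % p) := by
    ext j
    simp only [Finset.mem_filter, Finset.mem_Icc]
    omega
  rw [hf, Nat.card_Icc]
  have := Nat.div_add_mod n p
  simpa using this

theorem recPolyNat_monic_natDegree (a : Fin (p + 1) → ℂ) (n : ℕ) :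
    (recPolyNat a n).Monic ∧ (recPolyNat a n).natDegree = n := by
  induction n using Nat.strong_induction_on with
  | _ n ih =>
  rcases n with _ | n
  · simp [recPolyNat]
  · have hX : (X * recPolyNat a n).Monic := monic_X.mul (ih n (by omega)).1
    have hdX : (X * recPolyNat a n).natDegree = n + 1 := by
      rw [monic_X.natDegree_mul (ih n (by omega)).1, natDegree_X, (ih n (by omega)).2, add_comm]
    have hlt : (∑ k : Fin (p + 1), if (k : ℕ) ≤ n then C (a k) * recPolyNat a (n - k)
        else 0).degree < (X * recPolyNat a n).degree := by
      rw [degree_eq_natDegree hX.ne_zero, hdX]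
      refine (degree_sum_le _ _).trans_lt ((Finset.sup_lt_iff (WithBot.bot_lt_coe _)).2 ?_)
      intro k _
      split_ifs
      · rw [← smul_eq_C_mul]
        refine (degree_smul_le _ _).trans_lt ?_
        rw [degree_eq_natDegree (ih (n - k) (by omega)).1.ne_zero, (ih (n - k) (by omega)).2]
        exact_mod_cast (by omega : n - k < n + 1)
      · simp
    rw [recPolyNat_succ]
    exact ⟨hX.sub_of_left hlt, by
      rw [natDegree_eq_of_degree_eq (degree_sub_eq_left_of_degree_lt hlt), hdX]⟩

theorem IsOrderedSolution.isTypeIIHermitePade (hp : 1 ≤ p) {z : Fin (p + 1) → ℂ → ℂ}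
    (hz : IsOrderedSolution a z) (n : ℕ) :
    IsTypeIIHermitePade p (fun j w => z 0 w ^ j) (stair p n) (QPoly a n)
      (fun j => QPoly a (n - j)) := by
  refine ⟨(recPolyNat_monic_natDegree a n).1.ne_zero, ?_, fun j hj =>
    hz.isBigO_QPoly_mul_pow_sub n hj⟩
  rw [sum_stair hp]
  exact (recPolyNat_monic_natDegree a n).2.le

theorem tendsto_resolvent_apply_zero (a : Fin (p + 1) → ℂ) (x : Ell2) (n : ℕ) :
    Tendsto (fun w : ℂ => resolvent (toeplitzOp a) w x n) (cobounded ℂ) (𝓝 0) := by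
  -- For `N = 0` the vanishing condition is empty and the bound is `O(1 / w)`.
  refine (isBigO_resolvent_apply a x (n := n) (N := 0) (by simp)).trans_tendsto ?_
  simpa using tendsto_inv₀_cobounded (α := ℂ)

theorem IsOrderedSolution.tendsto_pow_zero {z : Fin (p + 1) → ℂ → ℂ}
    (hz : IsOrderedSolution a z) {j : ℕ} (hj : 1 ≤ j) :
    Tendsto (fun w => z 0 w ^ j) (cobounded ℂ) (𝓝 0) := by
  refine (tendsto_resolvent_apply_zero a (basisVec (j - 1)) 0).congr' ?_
  filter_upwards [eventually_mem_resolventSet a] with w hw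
  rw [hz.resolvent_apply_zero hw, Nat.sub_add_cancel hj]

theorem eventually_one_le_norm_eval {P : ℂ[X]} (hP : P.Monic) :
    ∀ᶠ w in cobounded ℂ, 1 ≤ ‖P.eval w‖ := by
  by_cases h : 0 < P.degree
  · exact (P.tendsto_norm_atTop h tendsto_norm_cobounded_atTop).eventually_ge_atTop 1
  · rw [hP.degree_pos, not_ne_iff] at h
    simp [h]

/-- The quotient is `z_0^j` minus a resolvent entry divided by `Q_n`, and a monic polynomial has
modulus at least one near infinity. -/
theorem IsOrderedSolution.tendsto_QPoly_div_zero {z : Fin (p + 1) → ℂ → ℂ}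
    (hz : IsOrderedSolution a z) {j : ℕ} (hj : 1 ≤ j) (n : ℕ) :
    Tendsto (fun w => (QPoly a (n - (j : ℕ))).eval w / (QPoly a n).eval w)
      (cobounded ℂ) (𝓝 0) := by
  have hge := eventually_one_le_norm_eval (recPolyNat_monic_natDegree a n).1
  have hx := tendsto_resolvent_apply_zero a (basisVec (j - 1)) n
  have hE : Tendsto (fun w => resolvent (toeplitzOp a) w (basisVec (j - 1)) n /
      (QPoly a n).eval w) (cobounded ℂ) (𝓝 0) := by
    refine squeeze_zero_norm' ?_ (by simpa using hx.norm)
    filter_upwards [hge] with w hw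
    rw [norm_div]
    exact div_le_self (norm_nonneg _) hw
  have h := (hz.tendsto_pow_zero hj).sub hE
  rw [sub_zero] at h
  refine h.congr' ?_
  filter_upwards [hge, eventually_mem_resolventSet a] with w hw hr
  have h0 : (QPoly a n).eval w ≠ 0 := norm_pos_iff.1 (zero_lt_one.trans_le hw)
  rw [← hz.QPoly_mul_pow_sub hr n hj]
  field_simp
  ring

end HermitePade

/-! ### Continuity of the ordered root moduli and their behaviour at infinity -/

section RootModuli

theorem eq_of_antitone_of_map_eq {N : ℕ} {f g : Fin N → ℝ} (hf : Antitone f) (hg : Antitone g)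
    (h : Finset.univ.val.map f = Finset.univ.val.map g) : f = g := by
  rw [Fin.univ_val_map, Fin.univ_val_map, Multiset.coe_eq_coe] at h
  exact List.ofFn_injective
    (h.eq_of_pairwise' hf.sortedGE_ofFn.pairwise hg.sortedGE_ofFn.pairwise)

theorem map_eq_of_prod_sub_eq {N : ℕ} {r s : Fin N → ℂ}
    (h : ∀ x : ℂ, ∏ k, (x - r k) = ∏ k, (x - s k)) :
    Finset.univ.val.map r = Finset.univ.val.map s := by
  have hpoly : ∏ k, (X - C (r k)) = ∏ k, (X - C (s k)) :=
    Polynomial.funext fun x => by simpa [eval_prod] using h x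
  have hroots : ∀ t : Fin N → ℂ, (∏ k, (X - C (t k))).roots = Finset.univ.val.map t := fun t => by
    rw [← roots_multiset_prod_X_sub_C (Finset.univ.val.map t), Multiset.map_map]
    rfl
  rw [← hroots r, ← hroots s, hpoly]

/-- A Cauchy bound: for `|x| > 1` every lower power is at most `|x| ^ p`, which can be cancelled. -/
theorem norm_root_le {c : Fin (p + 1) → ℂ} {x : ℂ}
    (hx : x ^ (p + 1) + ∑ k, c k * x ^ (p - k) = 0) : ‖x‖ ≤ 1 + ∑ k, ‖c k‖ := by
  have hs : 0 ≤ ∑ k, ‖c k‖ := Finset.sum_nonneg fun k _ => norm_nonneg _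
  rcases le_or_gt ‖x‖ 1 with h1 | h1
  · linarith
  · have h2 : ‖x‖ ^ p * ‖x‖ ≤ ‖x‖ ^ p * ∑ k, ‖c k‖ := by
      rw [← pow_succ, ← norm_pow, eq_neg_of_add_eq_zero_left hx, norm_neg, mul_comm,
        Finset.sum_mul]
      refine (norm_sum_le _ _).trans (Finset.sum_le_sum fun k _ => ?_)
      rw [norm_mul, norm_pow]
      gcongr
      · exact h1.le
      · omega
    have := le_of_mul_le_mul_left h2 (by positivity)
    linarith

/-- The ordered moduli of the roots of a monic polynomial depend continuously on its
coefficients. -/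
theorem tendsto_norm_roots {ι : Type*} {l : Filter ι} {c : ι → Fin (p + 1) → ℂ}
    {c₀ : Fin (p + 1) → ℂ} {r : ι → Fin (p + 1) → ℂ} {r₀ : Fin (p + 1) → ℂ}
    (hc : ∀ k, Tendsto (fun i => c i k) l (𝓝 (c₀ k)))
    (hr : ∀ᶠ i in l, ∀ x, ∏ k, (x - r i k) = x ^ (p + 1) + ∑ k, c i k * x ^ (p - k))
    (hr₀ : ∀ x, ∏ k, (x - r₀ k) = x ^ (p + 1) + ∑ k, c₀ k * x ^ (p - k))
    (hm : ∀ᶠ i in l, Antitone fun k => ‖r i k‖) (hm₀ : Antitone fun k => ‖r₀ k‖)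
    (k : Fin (p + 1)) : Tendsto (fun i => ‖r i k‖) l (𝓝 ‖r₀ k‖) := by
  -- Along an ultrafilter the bounded root vectors converge, so no matching of individual roots is
  -- needed: the limit has the right product, and sorting determines its moduli.
  rw [tendsto_iff_ultrafilter]
  intro U hU
  have hsum : Tendsto (fun i => ∑ k, ‖c i k‖) l (𝓝 (∑ k, ‖c₀ k‖)) :=
    tendsto_finsetSum _ fun k _ => (hc k).norm
  set B := 1 + (∑ k, ‖c₀ k‖ + 1)
  have hB : 0 ≤ B := by
    have : 0 ≤ ∑ k, ‖c₀ k‖ := Finset.sum_nonneg fun k _ => norm_nonneg _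
    linarith
  have hbdd : ∀ᶠ i in l, r i ∈ Metric.closedBall (0 : Fin (p + 1) → ℂ) B := by
    filter_upwards [hr, hsum.eventually_le_const (lt_add_one _)] with i h1 h2
    rw [mem_closedBall_zero_iff, pi_norm_le_iff_of_nonneg hB]
    intro k
    refine (norm_root_le (c := c i) ?_).trans (by linarith)
    rw [← h1]
    exact Finset.prod_eq_zero (Finset.mem_univ k) (sub_self _)
  obtain ⟨ζ, -, hζ⟩ := (isCompact_closedBall (0 : Fin (p + 1) → ℂ) B).ultrafilter_le_nhds
    (U.map r) (le_principal_iff.2 (hU hbdd))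
  have hζ' : Tendsto r U (𝓝 ζ) := hζ
  have hζk : ∀ k, Tendsto (fun i => r i k) U (𝓝 (ζ k)) := tendsto_pi_nhds.1 hζ'
  have hprod : ∀ x, ∏ k, (x - ζ k) = ∏ k, (x - r₀ k) := fun x => by
    have h1 : Tendsto (fun i => ∏ k, (x - r i k)) U (𝓝 (∏ k, (x - ζ k))) :=
      tendsto_finsetProd _ fun k _ => tendsto_const_nhds.sub (hζk k)
    have h2 : Tendsto (fun i => x ^ (p + 1) + ∑ k, c i k * x ^ (p - k)) U
        (𝓝 (x ^ (p + 1) + ∑ k, c₀ k * x ^ (p - k))) :=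
      tendsto_const_nhds.add
        (tendsto_finsetSum _ fun k _ => ((hc k).mono_left hU).mul tendsto_const_nhds)
    rw [hr₀]
    exact tendsto_nhds_unique_of_eventuallyEq h1 h2 ((hr.filter_mono hU).mono fun i hi => hi x)
  have hanti : Antitone fun k => ‖ζ k‖ := fun k m hkm =>
    le_of_tendsto_of_tendsto (hζk m).norm (hζk k).norm
      ((hm.filter_mono hU).mono fun i hi => hi hkm)
  have hmap := congrArg (Multiset.map norm) (map_eq_of_prod_sub_eq hprod)
  rw [Multiset.map_map, Multiset.map_map] at hmap
  have heq := congrFun (eq_of_antitone_of_map_eq hanti hm₀ hmap) k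
  rw [← heq]
  exact (hζk k).norm

variable {a : Fin (p + 1) → ℂ} {z : Fin (p + 1) → ℂ → ℂ}

theorem IsOrderedSolution.symbolPoly_eq_prod (hz : IsOrderedSolution a z) (w : ℂ) :
    symbolPoly a w = ∏ k, (1 - C (z k w)⁻¹ * X) := by
  have hspl := (IsAlgClosed.splits (symbolPoly a w)).eq_prod_roots
  rw [(hz w).1, Multiset.map_map] at hspl
  set c := (symbolPoly a w).leadingCoeff
  have hev : ∀ x, (symbolPoly a w).eval x = c * ∏ k, (x - z k w) := fun x => by
    have : (Multiset.map ((fun ζ => X - C ζ) ∘ fun k => z k w) Finset.univ.val).prod =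
        ∏ k, (X - C (z k w)) := rfl
    rw [hspl, this]
    simp [eval_prod]
  -- The constant term `1` of the polynomial fixes the normalisation.
  have h0 : c * ∏ k, (-z k w) = 1 := by
    have := hev 0
    simpa [symbolPoly, eval_finsetSum] using this.symm
  refine Polynomial.funext fun x => ?_
  have hfac : ∏ k, (x - z k w) = (∏ k, (-z k w)) * ∏ k, (1 - (z k w)⁻¹ * x) := by
    rw [← Finset.prod_mul_distrib]
    refine Finset.prod_congr rfl fun k _ => ?_
    have := hz.ne_zero k w
    field_simp
    ring
  rw [hev, hfac, ← mul_assoc, h0, one_mul]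
  simp [eval_prod]

/-- The reciprocals are the roots of the reversed polynomial, which is monic with coefficients
continuous in `w`. The identity is checked for nonzero `x` and extended by density. -/
theorem IsOrderedSolution.prod_sub_inv (hz : IsOrderedSolution a z) (w x : ℂ) :
    ∏ k, (x - (z k w)⁻¹) =
      x ^ (p + 1) + ∑ k, (a k - if k = 0 then w else 0) * x ^ (p - k) := by
  refine congrFun (Continuous.ext_on (dense_compl_singleton (0 : ℂ))
    (f := fun x => ∏ k, (x - (z k w)⁻¹))
    (g := fun x => x ^ (p + 1) + ∑ k, (a k - if k = 0 then w else 0) * x ^ (p - k))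
    (by fun_prop) (by fun_prop) fun y hy => ?_) x
  have hy0 : y ≠ 0 := hy
  have h1 := congrArg (eval y⁻¹) (hz.symbolPoly_eq_prod w)
  have h2 : ∏ k, (y - (z k w)⁻¹) = y ^ (p + 1) * ∏ k, (1 - (z k w)⁻¹ * y⁻¹) := by
    have : y ^ (p + 1) = ∏ _k : Fin (p + 1), y := by simp
    rw [this, ← Finset.prod_mul_distrib]
    exact Finset.prod_congr rfl fun k _ => by field_simp
  simp only [eval_prod, eval_sub, eval_one, eval_mul, eval_C, eval_X] at h1
  have h3 : ∀ k : Fin (p + 1), y ^ (p + 1) * (a k * y⁻¹ ^ ((k : ℕ) + 1)) = a k * y ^ (p - k) := by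
    intro k
    have hk : y ^ (p + 1) = y ^ (p - k) * y ^ ((k : ℕ) + 1) := by
      rw [← pow_add]
      congr 1
      omega
    rw [hk, inv_pow]
    field_simp
  dsimp only
  rw [h2, ← h1]
  simp only [symbolPoly, eval_sub, eval_add, eval_one, eval_finsetSum, eval_mul, eval_C, eval_pow,
    eval_X, sub_mul, Finset.sum_sub_distrib, ite_mul, zero_mul, Finset.sum_ite_eq',
    Finset.mem_univ, if_true, Fin.val_zero, Nat.sub_zero]
  rw [mul_sub, mul_add, Finset.mul_sum, Finset.sum_congr rfl fun k _ => h3 k]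
  field_simp
  ring

theorem IsOrderedSolution.antitone_norm_inv (hz : IsOrderedSolution a z) (w : ℂ) :
    Antitone fun k => ‖(z k w)⁻¹‖ := fun k m hkm => by
  simp only [norm_inv]
  exact inv_anti₀ (norm_pos_iff.2 (hz.ne_zero k w)) ((hz w).2 hkm)

theorem IsOrderedSolution.continuous_norm (hz : IsOrderedSolution a z) (k : Fin (p + 1)) :
    Continuous fun w => ‖z k w‖ := by
  have h : Continuous fun w => ‖(z k w)⁻¹‖ := continuous_iff_continuousAt.2 fun w₀ =>
    tendsto_norm_roots (l := 𝓝 w₀) (r := fun w k => (z k w)⁻¹)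
      (c := fun w k => a k - if k = 0 then w else 0)
      (fun k => by
        by_cases hk : k = 0
        · simpa [hk] using tendsto_const_nhds.sub tendsto_id
        · simp [hk])
      (Eventually.of_forall fun w => hz.prod_sub_inv w) (hz.prod_sub_inv w₀)
      (Eventually.of_forall hz.antitone_norm_inv) (hz.antitone_norm_inv w₀) k
  have h2 := h.inv₀ fun w => norm_ne_zero_iff.2 (inv_ne_zero (hz.ne_zero k w))
  exact h2.congr fun w => by simp

theorem IsOrderedSolution.prod_sub_inv_div (hz : IsOrderedSolution a z) {w : ℂ} (hw : w ≠ 0)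
    (x : ℂ) : ∏ k, (x - (z k w)⁻¹ / w) = x ^ (p + 1) +
      ∑ k, ((a k - if k = 0 then w else 0) / w ^ ((k : ℕ) + 1)) * x ^ (p - k) := by
  have h1 : w ^ (p + 1) * ∏ k, (x - (z k w)⁻¹ / w) = ∏ k, (w * x - (z k w)⁻¹) := by
    have : w ^ (p + 1) = ∏ _k : Fin (p + 1), w := by simp
    rw [this, ← Finset.prod_mul_distrib]
    refine Finset.prod_congr rfl fun k _ => ?_
    have := hz.ne_zero k w
    field_simp
  rw [hz.prod_sub_inv] at h1
  refine mul_left_cancel₀ (pow_ne_zero (p + 1) hw) ?_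
  rw [h1, mul_add, mul_pow, Finset.mul_sum]
  congr 1
  refine Finset.sum_congr rfl fun k _ => ?_
  have hk : w ^ (p + 1) = w ^ (p - k) * w ^ ((k : ℕ) + 1) := by
    rw [← pow_add]
    congr 1
    omega
  rw [hk, mul_pow]
  field_simp

/-- After division by `w` the polynomial of the reciprocals tends to `x ^ (p + 1) - x ^ p`, with
roots `1, 0, …, 0`. -/
theorem IsOrderedSolution.tendsto_norm_inv_div (hz : IsOrderedSolution a z) (k : Fin (p + 1)) :
    Tendsto (fun w => ‖(z k w)⁻¹ / w‖) (cobounded ℂ) (𝓝 (if k = 0 then 1 else 0)) := by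
  have hinv : ∀ m : ℕ, Tendsto (fun w : ℂ => (w ^ (m + 1))⁻¹) (cobounded ℂ) (𝓝 0) := fun m => by
    simpa using (tendsto_inv₀_cobounded (α := ℂ)).pow (m + 1)
  have h := tendsto_norm_roots (l := cobounded ℂ) (r := fun w k => (z k w)⁻¹ / w)
    (c := fun w k => (a k - if k = 0 then w else 0) / w ^ ((k : ℕ) + 1))
    (c₀ := fun k => if k = 0 then -1 else 0) (r₀ := fun k => if k = 0 then 1 else 0)
    (fun k => by
      by_cases hk : k = 0
      · subst hk
        have := ((hinv 0).const_mul (a 0)).sub_const 1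
        simp only [mul_zero, zero_sub] at this
        simp only [if_true]
        refine this.congr' ?_
        filter_upwards [eventually_ne_cobounded (0 : ℂ)] with w hw
        simp only [Fin.val_zero, zero_add, pow_one]
        field_simp
      · simpa [hk, div_eq_mul_inv] using (hinv k).const_mul (a k))
    (by
      filter_upwards [eventually_ne_cobounded (0 : ℂ)] with w hw
      exact hz.prod_sub_inv_div hw)
    (fun x => by
      rw [Fin.prod_univ_succ, Fin.sum_univ_succ]
      simp [Fin.succ_ne_zero]
      ring)
    (Eventually.of_forall fun w k m hkm => by
      simp only [norm_div]
      gcongr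
      exact hz.antitone_norm_inv w hkm)
    (fun k m hkm => by
      by_cases hm : m = 0
      · subst hm
        simp [Fin.le_zero_iff.1 hkm]
      · simp [hm])
    k
  convert h using 2
  split_ifs <;> simp

/-- The quotient of the moduli of the two smallest solutions tends to zero at infinity. -/
theorem IsOrderedSolution.tendsto_norm_div_norm (hz : IsOrderedSolution a z) {k : Fin (p + 1)}
    (hk : k ≠ 0) : Tendsto (fun w => ‖z 0 w‖ / ‖z k w‖) (cobounded ℂ) (𝓝 0) := by
  have h := (hz.tendsto_norm_inv_div k).div (hz.tendsto_norm_inv_div 0) (by simp)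
  simp only [hk, if_false, zero_div] at h
  refine h.congr' ?_
  filter_upwards [eventually_ne_cobounded (0 : ℂ)] with w hw
  have h0 := norm_ne_zero_iff.2 (hz.ne_zero 0 w)
  have h1 := norm_ne_zero_iff.2 (hz.ne_zero k w)
  have h2 := norm_ne_zero_iff.2 hw
  simp only [Pi.div_apply, norm_div, norm_inv]
  field_simp

/-- A continuous function on the plane that tends to zero at infinity extends continuously to the
extended plane. -/
theorem continuous_elim_zero {f : ℂ → ℝ} (hf : Continuous f)
    (h0 : Tendsto f (cobounded ℂ) (𝓝 0)) :
    Continuous fun w : OnePoint ℂ => w.elim 0 f := by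
  rw [OnePoint.continuous_iff]
  refine ⟨?_, hf⟩
  rw [coclosedCompact_eq_cocompact, ← Metric.cobounded_eq_cocompact]
  exact h0

theorem IsOrderedSolution.exists_norm_zero_le (hz : IsOrderedSolution a z) {K : Set (OnePoint ℂ)}
    (hK : IsCompact K) : ∃ B, ∀ w : ℂ, (w : OnePoint ℂ) ∈ K → ‖z 0 w‖ ≤ B := by
  have hlim : Tendsto (fun w => ‖z 0 w‖) (cobounded ℂ) (𝓝 0) := by
    simpa using (hz.tendsto_pow_zero le_rfl).norm
  obtain ⟨B, hB⟩ := hK.exists_bound_of_continuousOn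
    (continuous_elim_zero (hz.continuous_norm 0) hlim).continuousOn
  exact ⟨B, fun w hw => (le_abs_self _).trans (hB w hw)⟩

theorem IsOrderedSolution.exists_norm_div_norm_le (hz : IsOrderedSolution a z)
    {k : Fin (p + 1)} (hk : k ≠ 0) {K : Set (OnePoint ℂ)} (hK : IsCompact K)
    (hlt : ∀ w : ℂ, (w : OnePoint ℂ) ∈ K → ‖z 0 w‖ < ‖z k w‖) :
    ∃ q, 0 < q ∧ q < 1 ∧ ∀ w : ℂ, (w : OnePoint ℂ) ∈ K → ‖z 0 w‖ / ‖z k w‖ ≤ q := by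
  have hcont := continuous_elim_zero ((hz.continuous_norm 0).div (hz.continuous_norm k)
    fun w => norm_ne_zero_iff.2 (hz.ne_zero k w)) (hz.tendsto_norm_div_norm hk)
  rcases K.eq_empty_or_nonempty with rfl | hne
  · exact ⟨1 / 2, by norm_num, by norm_num, by simp⟩
  obtain ⟨x, hx, hmax⟩ := hK.exists_isMaxOn hne hcont.continuousOn
  have key : ∀ y ∈ K, 0 ≤ y.elim 0 (fun w => ‖z 0 w‖ / ‖z k w‖) ∧
      y.elim 0 (fun w => ‖z 0 w‖ / ‖z k w‖) < 1 := by
    intro y hy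
    induction y using OnePoint.rec with
    | infty => simp
    | coe w =>
      refine ⟨by simp only [OnePoint.elim_some]; positivity, ?_⟩
      simp only [OnePoint.elim_some]
      exact (div_lt_one (norm_pos_iff.2 (hz.ne_zero k w))).2 (hlt w hy)
  obtain ⟨h0, h1⟩ := key x hx
  set q := x.elim 0 (fun w => ‖z 0 w‖ / ‖z k w‖)
  -- The midpoint with `1` is positive even if the maximum is zero, as for `K = {∞}`.
  refine ⟨(q + 1) / 2, by linarith, by linarith, fun w hw => ?_⟩
  have : ‖z 0 w‖ / ‖z k w‖ ≤ q := hmax hw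
  linarith

end RootModuli

/-! ### Generating functions and ratio asymptotics -/

section RatioAsymptotics

/-- The power series `1 + x X + x ^ 2 X ^ 2 + ⋯`. -/
def geomSeries (x : ℂ) : PowerSeries ℂ := PowerSeries.mk fun n => x ^ n

theorem one_sub_mul_geomSeries (x : ℂ) :
    (1 - PowerSeries.C x * PowerSeries.X) * geomSeries x = 1 := by
  ext n
  rw [sub_mul, one_mul, mul_assoc, map_sub, PowerSeries.coeff_C_mul]
  rcases n with _ | n
  · simp [geomSeries]
  · rw [PowerSeries.coeff_succ_X_mul]
    simp [geomSeries, PowerSeries.coeff_one, pow_succ']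

/-- Each new factor costs a convolution of `n + 1` terms, all under the previous bound; this makes
the tail estimate uniform in `x`. -/
theorem norm_coeff_prod_geomSeries_le {ι : Type*} (s : Finset ι) {x : ι → ℂ} {q : ℝ} (hq : 0 ≤ q)
    (hx : ∀ k ∈ s, ‖x k‖ ≤ q) (n : ℕ) :
    ‖PowerSeries.coeff n (∏ k ∈ s, geomSeries (x k))‖ ≤ ((n : ℝ) + 1) ^ s.card * q ^ n := by
  classical
  induction s using Finset.induction_on generalizing n with
  | empty =>
    rw [Finset.prod_empty, PowerSeries.coeff_one]
    split_ifs with h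
    · simp [h]
    · rw [norm_zero]
      positivity
  | insert k s hk ih =>
    rw [Finset.prod_insert hk, mul_comm, PowerSeries.coeff_mul, Finset.card_insert_of_notMem hk]
    refine (norm_sum_le _ _).trans ?_
    have hterm : ∀ ij ∈ Finset.HasAntidiagonal.antidiagonal n,
        ‖PowerSeries.coeff ij.1 (∏ k ∈ s, geomSeries (x k)) *
          PowerSeries.coeff ij.2 (geomSeries (x k))‖ ≤ ((n : ℝ) + 1) ^ s.card * q ^ n := by
      intro ij hij
      rw [Finset.HasAntidiagonal.mem_antidiagonal] at hij
      have h1 := ih (fun i hi => hx i (Finset.mem_insert_of_mem hi)) ij.1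
      have h2 : ‖PowerSeries.coeff ij.2 (geomSeries (x k))‖ ≤ q ^ ij.2 := by
        rw [geomSeries, PowerSeries.coeff_mk, norm_pow]
        gcongr
        exact hx k (Finset.mem_insert_self k s)
      have h3 : (ij.1 : ℝ) ≤ n := by exact_mod_cast (by omega : ij.1 ≤ n)
      rw [norm_mul]
      calc _ ≤ (((ij.1 : ℝ) + 1) ^ s.card * q ^ ij.1) * q ^ ij.2 := by gcongr
        _ = ((ij.1 : ℝ) + 1) ^ s.card * q ^ n := by rw [mul_assoc, ← pow_add, hij]
        _ ≤ _ := by gcongr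
    refine (Finset.sum_le_card_nsmul _ _ _ hterm).trans (le_of_eq ?_)
    rw [Finset.Nat.card_antidiagonal, nsmul_eq_mul]
    push_cast
    ring

theorem summable_tsum_coeff_prod_geomSeries {ι : Type*} (s : Finset ι) {x : ι → ℂ}
    (hx : ∀ k ∈ s, ‖x k‖ < 1) :
    (Summable fun n => ‖PowerSeries.coeff n (∏ k ∈ s, geomSeries (x k))‖) ∧
      ∑' n, PowerSeries.coeff n (∏ k ∈ s, geomSeries (x k)) = ∏ k ∈ s, (1 - x k)⁻¹ := by
  classical
  induction s using Finset.induction_on with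
  | empty =>
    simp only [Finset.prod_empty, PowerSeries.coeff_one]
    refine ⟨summable_of_ne_finset_zero (s := {0}) fun n hn => ?_, ?_⟩
    · simpa using hn
    · rw [tsum_eq_single 0 fun n hn => if_neg hn, if_pos rfl]
  | insert k s hk ih =>
    obtain ⟨h1, h2⟩ := ih fun i hi => hx i (Finset.mem_insert_of_mem hi)
    have hxk := hx k (Finset.mem_insert_self k s)
    have hg : Summable fun n => ‖PowerSeries.coeff n (geomSeries (x k))‖ := by
      simpa [geomSeries] using summable_geometric_of_lt_one (norm_nonneg _) hxk
    have hgt : ∑' n, PowerSeries.coeff n (geomSeries (x k)) = (1 - x k)⁻¹ := by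
      simpa [geomSeries] using tsum_geometric_of_norm_lt_one hxk
    have hmul := fun n =>
      PowerSeries.coeff_mul n (geomSeries (x k)) (∏ k ∈ s, geomSeries (x k))
    rw [Finset.prod_insert hk, Finset.prod_insert hk, ← h2, ← hgt,
      tsum_mul_tsum_eq_tsum_sum_antidiagonal_of_summable_norm hg h1]
    refine ⟨?_, tsum_congr hmul⟩
    exact (summable_norm_sum_mul_antidiagonal_of_summable_norm hg h1).congr fun n =>
      congrArg norm (hmul n).symm

/-- The tails of the series `∑ (m + 1) ^ p q ^ m`. -/
noncomputable def polyGeomTail (p : ℕ) (q : ℝ) (N : ℕ) : ℝ :=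
  ∑' m : ℕ, (((m + N : ℕ) : ℝ) + 1) ^ p * q ^ (m + N)

theorem summable_polyGeom (p : ℕ) {q : ℝ} (hq : 0 < q) (hq1 : q < 1) :
    Summable fun m : ℕ => ((m : ℝ) + 1) ^ p * q ^ m := by
  have h := (summable_nat_add_iff (f := fun m : ℕ => (m : ℝ) ^ p * q ^ m) 1).2
    (summable_pow_mul_geometric_of_norm_lt_one p
    (by rwa [Real.norm_of_nonneg hq.le] : ‖q‖ < 1))
  refine (h.mul_left q⁻¹).congr fun m => ?_
  rw [pow_succ]
  push_cast
  field_simp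

theorem tendsto_polyGeomTail (p : ℕ) (q : ℝ) : Tendsto (polyGeomTail p q) atTop (𝓝 0) :=
  _root_.tendsto_sum_nat_add fun m : ℕ => ((m : ℝ) + 1) ^ p * q ^ m

theorem norm_sum_coeff_sub_le {x : Fin p → ℂ} {q : ℝ} (hq : 0 < q) (hq1 : q < 1)
    (hx : ∀ k, ‖x k‖ ≤ q) (N : ℕ) :
    ‖∑ m ∈ Finset.range N, PowerSeries.coeff m (∏ k, geomSeries (x k)) - ∏ k, (1 - x k)⁻¹‖ ≤
      polyGeomTail p q N := by
  obtain ⟨h1, h2⟩ := summable_tsum_coeff_prod_geomSeries Finset.univ (x := x)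
    fun k _ => (hx k).trans_lt hq1
  rw [← h2, ← h1.of_norm.sum_add_tsum_nat_add N, sub_add_cancel_left, norm_neg]
  have hb := fun m : ℕ => norm_coeff_prod_geomSeries_le Finset.univ (x := x) hq.le
    (fun k _ => hx k) m
  simp only [Finset.card_univ, Fintype.card_fin] at hb
  exact tsum_of_norm_bounded
    ((summable_nat_add_iff N).2 (summable_polyGeom p hq hq1)).hasSum fun m => hb (m + N)

/-- Keeps the limit of `z_0^n Q_n` away from zero by a constant independent of `w`. -/
theorem le_norm_prod_one_sub_inv {x : Fin p → ℂ} (hx : ∀ k, ‖x k‖ < 1) :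
    (1 / 2 : ℝ) ^ p ≤ ‖∏ k, (1 - x k)⁻¹‖ := by
  rw [norm_prod]
  have h : ∀ k ∈ (Finset.univ : Finset (Fin p)), (1 / 2 : ℝ) ≤ ‖(1 - x k)⁻¹‖ := fun k _ => by
    have h1 : ‖1 - x k‖ ≤ 2 := by
      refine (norm_sub_le _ _).trans ?_
      rw [norm_one]
      linarith [hx k]
    have h2 : 0 < ‖1 - x k‖ := norm_pos_iff.2 fun h0 => by
      have := hx k
      rw [← sub_eq_zero.1 h0, norm_one] at this
      exact lt_irrefl _ this
    rw [norm_inv, one_div]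
    exact inv_anti₀ h2 h1
  simpa using Finset.prod_le_prod (fun _ _ => by norm_num) h

variable {a : Fin (p + 1) → ℂ} {z : Fin (p + 1) → ℂ → ℂ}

theorem mk_QPoly_mul_symbolPoly (a : Fin (p + 1) → ℂ) (w : ℂ) :
    PowerSeries.mk (fun n : ℕ => (QPoly a n).eval w) * (symbolPoly a w : PowerSeries ℂ) = 1 := by
  have hcoe : (symbolPoly a w : PowerSeries ℂ) =
      1 + ∑ k : Fin (p + 1), PowerSeries.X ^ ((k : ℕ) + 1) * PowerSeries.C (a k) -
        PowerSeries.X * PowerSeries.C w := by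
    have := map_sum (coeToPowerSeries.ringHom (R := ℂ))
      (fun k : Fin (p + 1) => C (a k) * X ^ ((k : ℕ) + 1)) Finset.univ
    simp only [coeToPowerSeries.ringHom_apply] at this
    rw [symbolPoly, coe_sub, coe_add, this]
    simp only [coe_one, coe_mul, coe_C, coe_pow, coe_X, mul_comm (PowerSeries.C _)]
  ext n
  rw [hcoe, mul_sub, mul_add, mul_one, Finset.mul_sum, map_sub, map_add, map_sum]
  simp only [← mul_assoc, PowerSeries.coeff_mul_C, PowerSeries.coeff_mul_X_pow']
  rcases n with _ | n
  · simp [QPoly_zero]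
  · rw [PowerSeries.coeff_succ_mul_X]
    simp only [PowerSeries.coeff_mk, PowerSeries.coeff_one, QPoly_natCast, recPolyNat_succ,
      Nat.add_le_add_iff_right, Nat.add_sub_add_right, eval_sub, eval_mul, eval_X, eval_finsetSum]
    have : ∀ k : Fin (p + 1), (if (k : ℕ) ≤ n then eval w (recPolyNat a (n - k)) else 0) * a k =
        eval w (if (k : ℕ) ≤ n then C (a k) * recPolyNat a (n - k) else 0) := fun k => by
      split_ifs <;> simp [mul_comm]
    simp only [this, if_neg (Nat.succ_ne_zero n)]
    ring

theorem IsOrderedSolution.mk_QPoly_eq_prod (hz : IsOrderedSolution a z) (w : ℂ) :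
    PowerSeries.mk (fun n : ℕ => (QPoly a n).eval w) = ∏ k, geomSeries (z k w)⁻¹ := by
  refine left_inv_eq_right_inv (mk_QPoly_mul_symbolPoly a w) ?_
  have hcoe : (symbolPoly a w : PowerSeries ℂ) =
      ∏ k, (1 - PowerSeries.C (z k w)⁻¹ * PowerSeries.X) := by
    rw [hz.symbolPoly_eq_prod]
    have := map_prod (coeToPowerSeries.ringHom (R := ℂ))
      (fun k : Fin (p + 1) => 1 - C (z k w)⁻¹ * X) Finset.univ
    simpa only [coeToPowerSeries.ringHom_apply, coe_sub, coe_one, coe_mul, coe_C, coe_X] using this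
  rw [hcoe, ← Finset.prod_mul_distrib]
  exact Finset.prod_eq_one fun k _ => one_sub_mul_geomSeries _

/-- Rescaling by `z_0` turns the factor of index `0` into `1 / (1 - X)`, and multiplying by that
takes partial sums of coefficients. -/
theorem IsOrderedSolution.pow_mul_QPoly (hz : IsOrderedSolution a z) (w : ℂ) (n : ℕ) :
    z 0 w ^ n * (QPoly a n).eval w = ∑ m ∈ Finset.range (n + 1),
      PowerSeries.coeff m (∏ k : Fin p, geomSeries (z 0 w * (z k.succ w)⁻¹)) := by
  have h := congrArg (PowerSeries.rescale (z 0 w)) (hz.mk_QPoly_eq_prod w)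
  have hg : ∀ x, PowerSeries.rescale (z 0 w) (geomSeries x) = geomSeries (z 0 w * x) := fun x => by
    simp only [geomSeries, PowerSeries.rescale_mk, mul_pow]
  rw [PowerSeries.rescale_mk, map_prod, Fin.prod_univ_succ, hg,
    mul_inv_cancel₀ (hz.ne_zero 0 w), mul_comm] at h
  simp only [hg] at h
  have hn := congrArg (PowerSeries.coeff n) h
  rw [PowerSeries.coeff_mk, PowerSeries.coeff_mul] at hn
  rw [hn]
  simp only [geomSeries, one_pow, PowerSeries.coeff_mk, mul_one]
  rw [Finset.Nat.sum_antidiagonal_eq_sum_range_succ_mk]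

theorem IsOrderedSolution.exists_norm_pow_mul_QPoly_sub_le (hz : IsOrderedSolution a z) {w : ℂ}
    {q : ℝ} (hq : 0 < q) (hq1 : q < 1) (hw : ∀ k : Fin p, ‖z 0 w‖ / ‖z k.succ w‖ ≤ q) :
    ∃ L : ℂ, (1 / 2 : ℝ) ^ p ≤ ‖L‖ ∧
      ∀ n : ℕ, ‖z 0 w ^ n * (QPoly a n).eval w - L‖ ≤ polyGeomTail p q (n + 1) := by
  have hx : ∀ k : Fin p, ‖z 0 w * (z k.succ w)⁻¹‖ ≤ q := fun k => by
    rw [norm_mul, norm_inv, ← div_eq_mul_inv]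
    exact hw k
  refine ⟨_, le_norm_prod_one_sub_inv fun k => (hx k).trans_lt hq1, fun n => ?_⟩
  rw [hz.pow_mul_QPoly]
  exact norm_sum_coeff_sub_le hq hq1 hx (n + 1)

/-- A quantitative form of the ratio asymptotics. -/
theorem IsOrderedSolution.norm_QPoly_div_sub_le (hz : IsOrderedSolution a z) {w : ℂ}
    {q B : ℝ} (hq : 0 < q) (hq1 : q < 1) (hw : ∀ k : Fin p, ‖z 0 w‖ / ‖z k.succ w‖ ≤ q)
    (hB : ‖z 0 w‖ ≤ B) {n : ℕ} (hn : polyGeomTail p q (n + 1) ≤ (1 / 2) ^ (p + 1)) :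
    (QPoly a n).eval w ≠ 0 ∧ ∀ j ≤ n,
      ‖z 0 w ^ j - (QPoly a (n - (j : ℕ))).eval w / (QPoly a n).eval w‖ ≤
        B ^ j * (polyGeomTail p q (n + 1) + polyGeomTail p q (n - j + 1)) * 2 ^ (p + 1) := by
  obtain ⟨L, hL, hT⟩ := hz.exists_norm_pow_mul_QPoly_sub_le hq hq1 hw
  have hz0 := hz.ne_zero 0 w
  -- The error is at most half of the lower bound for `L`, so the other half survives.
  have hlow : (1 / 2 : ℝ) ^ (p + 1) ≤ ‖z 0 w ^ n * (QPoly a n).eval w‖ := by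
    have h1 := norm_sub_norm_le L (z 0 w ^ n * (QPoly a n).eval w)
    rw [norm_sub_rev] at h1
    have h2 := hT n
    have h3 : (1 / 2 : ℝ) ^ p = 2 * (1 / 2) ^ (p + 1) := by rw [pow_succ]; ring
    linarith
  have hpos : 0 < ‖z 0 w ^ n * (QPoly a n).eval w‖ := lt_of_lt_of_le (by positivity) hlow
  have hne : (QPoly a n).eval w ≠ 0 := right_ne_zero_of_mul (norm_pos_iff.1 hpos)
  refine ⟨hne, fun j hj => ?_⟩
  -- Both normalised polynomials have the same limit `L`, which cancels and leaves the two errors.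
  have heq : z 0 w ^ j - (QPoly a (n - (j : ℕ))).eval w / (QPoly a n).eval w =
      z 0 w ^ j * ((z 0 w ^ n * (QPoly a n).eval w - L) -
        (z 0 w ^ (n - j) * (QPoly a (n - j : ℕ)).eval w - L)) *
        (z 0 w ^ n * (QPoly a n).eval w)⁻¹ := by
    have hpow : z 0 w ^ n = z 0 w ^ j * z 0 w ^ (n - j) := by rw [← pow_add, Nat.add_sub_cancel' hj]
    rw [Nat.cast_sub hj, hpow]
    field_simp
    ring
  rw [heq, norm_mul, norm_mul, norm_pow, norm_inv]
  have hinv : ‖z 0 w ^ n * (QPoly a n).eval w‖⁻¹ ≤ 2 ^ (p + 1) := by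
    have := inv_anti₀ (by positivity) hlow
    simpa using this
  have hB0 : 0 ≤ B := (norm_nonneg _).trans hB
  gcongr
  · exact mul_nonneg (pow_nonneg hB0 j)
      (add_nonneg ((norm_nonneg _).trans (hT n)) ((norm_nonneg _).trans (hT (n - j))))
  · exact (norm_sub_le _ _).trans (add_le_add (hT n) (hT (n - j)))

theorem IsOrderedSolution.ratio_asymptotics (hp : 1 ≤ p) (hz : IsOrderedSolution a z)
    {K : Set (OnePoint ℂ)} (hK : IsCompact K)
    (hdisj : Disjoint K ((fun w : ℂ => (w : OnePoint ℂ)) '' Gamma z ⟨0, hp⟩)) (j : ℕ) :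
    (∀ᶠ n : ℕ in atTop, ∀ w : ℂ, (w : OnePoint ℂ) ∈ K → (QPoly a n).eval w ≠ 0) ∧
      TendstoUniformlyOn
        (fun n : ℕ => extendByZero fun w => (QPoly a (n - (j : ℕ))).eval w / (QPoly a n).eval w)
        (extendByZero fun w => z 0 w ^ j) atTop K := by
  obtain ⟨B, hB⟩ := hz.exists_norm_zero_le hK
  obtain ⟨q, hq, hq1, hqK⟩ := hz.exists_norm_div_norm_le (Fin.succ_ne_zero ⟨0, hp⟩) hK
    fun w hw => lt_of_le_of_ne ((hz w).2 (Fin.zero_le _)) fun h =>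
      Set.disjoint_left.1 hdisj hw ⟨w, h, rfl⟩
  -- By the ordering, the bound for `z_1` serves all later roots.
  have hqK' : ∀ w : ℂ, (w : OnePoint ℂ) ∈ K → ∀ k : Fin p, ‖z 0 w‖ / ‖z k.succ w‖ ≤ q := by
    intro w hw k
    refine le_trans ?_ (hqK w hw)
    refine div_le_div_of_nonneg_left (norm_nonneg _) (norm_pos_iff.2 (hz.ne_zero _ w)) ?_
    exact (hz w).2 (Fin.succ_le_succ_iff.2 (Fin.mk_le_of_le_val (Nat.zero_le _)))
  have htail : Tendsto (fun n => polyGeomTail p q (n + 1)) atTop (𝓝 0) :=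
    (tendsto_add_atTop_iff_nat 1).2 (tendsto_polyGeomTail p q)
  have hsmall : ∀ᶠ n in atTop, polyGeomTail p q (n + 1) ≤ (1 / 2) ^ (p + 1) :=
    htail.eventually_le_const (by positivity)
  refine ⟨hsmall.mono fun n hn w hw =>
    (hz.norm_QPoly_div_sub_le hq hq1 (hqK' w hw) (hB w hw) hn).1, ?_⟩
  have hbound : Tendsto (fun n => B ^ j * (polyGeomTail p q (n + 1) +
      polyGeomTail p q (n - j + 1)) * 2 ^ (p + 1)) atTop (𝓝 0) := by
    simpa using ((htail.add (htail.comp (tendsto_sub_atTop_nat j))).const_mul (B ^ j)).mul_const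
      (2 ^ (p + 1))
  rw [Metric.tendstoUniformlyOn_iff]
  intro ε hε
  filter_upwards [hsmall, hbound.eventually_lt_const hε, eventually_ge_atTop j] with n h1 h2 h3 x hx
  induction x using OnePoint.rec with
  | infty => simpa [extendByZero] using hε
  | coe w =>
    rw [dist_eq_norm]
    exact ((hz.norm_QPoly_div_sub_le hq hq1 (hqK' w hx) (hB w hx) h1).2 j h3).trans_lt h2

end RatioAsymptotics

end ToeplitzRec

theorem mainTheorem1 (p : ℕ) (hp : 1 ≤ p) (a : Fin (p + 1) → ℂ) (ha : a (Fin.last p) ≠ 0)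
    (z : Fin (p + 1) → ℂ → ℂ) (hz : IsOrderedSolution a z) :
    -- i) equality where the resolvent exists, and equality of the Laurent expansions at infinity
    (∀ j ∈ Finset.Icc 1 p,
      (∀ w ∈ resolventSet ℂ (toeplitzOp a), resolventFun a j w = z 0 w ^ j) ∧
      ∃ c : ℕ → ℂ, HasLaurentAtInfty (resolventFun a j) c ∧ HasLaurentAtInfty (fun w => z 0 w ^ j) c) ∧
    -- ii) multiple orthogonality
    (∀ n : ℕ, ∀ j ∈ Finset.Icc 1 p, ∀ k < stair p n j, LFun a j (X ^ k * QPoly a n) = 0) ∧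
    -- iii) type II Hermite–Padé approximation
    (∀ n : ℕ, IsTypeIIHermitePade p (fun j w => z 0 w ^ j) (stair p n) (QPoly a n)
      (fun j => QPoly a (n - j))) ∧
    -- iv) ratio asymptotics; the functions involved vanish at infinity, so that extending them by
    -- zero is extending them continuously, and the denominators have no zeros on `K` eventually
    (∀ j ∈ Finset.Icc 1 p,
      Tendsto (fun w => z 0 w ^ j) (cobounded ℂ) (𝓝 0) ∧
      (∀ n : ℕ, Tendsto (fun w => (QPoly a (n - j)).eval w / (QPoly a n).eval w) (cobounded ℂ) (𝓝 0)) ∧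
      ∀ K : Set (OnePoint ℂ), IsCompact K →
        Disjoint K ((fun w : ℂ => (w : OnePoint ℂ)) '' Gamma z ⟨0, hp⟩) →
        (∀ᶠ n : ℕ in atTop, ∀ w : ℂ, (w : OnePoint ℂ) ∈ K → (QPoly a n).eval w ≠ 0) ∧
        TendstoUniformlyOn
          (fun n : ℕ => extendByZero fun w => (QPoly a (n - j)).eval w / (QPoly a n).eval w)
          (extendByZero fun w => z 0 w ^ j) atTop K) := by
  refine ⟨fun j hj => ?_, fun n j hj k hk => LFun_X_pow_mul_QPoly a hj hk,
    hz.isTypeIIHermitePade hp, fun j hj => ?_⟩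
  · have hj1 := (Finset.mem_Icc.1 hj).1
    refine ⟨fun w hw => hz.resolventFun_eq hw hj1, _, hasLaurentAtInfty_resolventFun a j, ?_⟩
    filter_upwards [hasLaurentAtInfty_resolventFun a j, eventually_mem_resolventSet a]
      with w h1 h2
    rwa [hz.resolventFun_eq h2 hj1] at h1
  · have hj1 := (Finset.mem_Icc.1 hj).1
    exact ⟨hz.tendsto_pow_zero hj1, hz.tendsto_QPoly_div_zero hj1,
      fun K hK hdisj => hz.ratio_asymptotics hp hK hdisj j⟩
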